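/- For $\lambda,\nu>0$ let $Z(\lambda,\nu)=\sum_{i=0}^\infty \frac{\lambda^i}{(i!)^\nu}$ (a convergent series) be the normalizing constant of the Conway--Maxwell--Poisson distribution. Then the following hold. (a) For every fixed real $\nu>0$, $$Z(\lambda,\nu)=\frac{\exp\{\nu\lambda^{1/\nu}\}}{\lambda^{(\nu-1)/(2\nu)}(2\pi)^{(\nu-1)/2}\sqrt{\nu}}\left(1+\mathcal{O}\left(\lambda^{-1/\nu}\right)\right)\quad\text{as }\lambda\to\infty,$$ where the implied constant may depend on $\nu$. (b) For all $\lambda,\nu>0$, with $\alpha=\lambda^{1/\nu}$ and $X_\alpha\sim\mathrm{Po}(\alpha)$, the random variable $(\alpha^{X_\alpha}/X_\alpha!)^{\nu-1}$ is integrable and $$Z(\lambda,\nu)=e^{\alpha}\,\mathbb{E}\left[\left(\frac{\alpha^{X_\alpha}}{X_\alpha!}\right)^{\nu-1}\right].$$ (c) Let $X_\alpha\sim\mathrm{Po}(\alpha)$ for $\alpha>0$, let $\tilde X_\alpha=(X_\alpha-\alpha)/\sqrt{\alpha}$, let $N\sim N(0,1)$, and let $h:\mathbb{R}\to\mathbb{R}$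 be a function not depending on $\alpha$. (i) If $h$ is differentiable with bounded derivative on $\mathbb{R}$, then $h(N)$ and all $h(\tilde X_\alpha)$ are integrable, and $\mathbb{E}[h(\tilde X_\alpha)]=\mathbb{E}[h(N)]+\mathcal{O}(\alpha^{-1/2})$ as $\alpha\to\infty$. (ii) If $h$ is even and twice differentiable with first and second derivatives bounded on $\mathbb{R}$, then $\mathbb{E}[h(\tilde X_\alpha)]=\mathbb{E}[h(N)]+\mathcal{O}(\alpha^{-1})$ as $\alpha\to\infty$. The implied constants in (c) may depend on $h$. -/

import Mathlib

open Filter MeasureTheory ProbabilityTheory Asymptotics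

/-- The normalizing constant `Z(lam, ν) = ∑ lam ^ i / (i!) ^ ν` of the
Conway-Maxwell-Poisson distribution with parameters `lam` and `ν`. -/
noncomputable def cmpZ (lam ν : ℝ) : ℝ :=
  ∑' i : ℕ, lam ^ i / (Nat.factorial i : ℝ) ^ ν

/-- The leading-order approximation of `cmpZ lam ν` as `lam → ∞`. -/
noncomputable def cmpLeading (lam ν : ℝ) : ℝ :=
  Real.exp (ν * lam ^ (1 / ν)) /
    (lam ^ ((ν - 1) / (2 * ν)) * (2 * Real.pi) ^ ((ν - 1) / 2) * Real.sqrt ν)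

/-- The law `Po(α)`, for a real parameter `α` (used for `α > 0` only). -/
noncomputable def poissonLaw (α : ℝ) : Measure ℕ :=
  poissonMeasure α.toNNReal

/-- The expectation `E[h((X - α) / √α)]` for `X ∼ Po(α)`. -/
noncomputable def stdPoissonExp (h : ℝ → ℝ) (α : ℝ) : ℝ :=
  ∫ k : ℕ, h (((k : ℝ) - α) / Real.sqrt α) ∂(poissonLaw α)

/-- The expectation `E[h(Z)]` for `Z ∼ N(0, 1)`. -/
noncomputable def stdNormalExp (h : ℝ → ℝ) : ℝ :=
  ∫ x : ℝ, h x ∂(gaussianReal 0 1)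

/-! With `α = lam ^ (1/ν)` the summands of `Z` become `(α ^ k / k!) ^ ν`. Let `K` have these
weights, normalised. The ratio of consecutive weights gives the Stein identity `E[(K/α)^ν g(K)] =
E[g(K+1)]`, and everything rests on it.

For (a), `lam * Z'/Z = E[K]`, so a sharp enough mean determines `log Z` up to a constant. Put `Y =
K/α - 1`. Odd powers of `Y` as test functions give `E[Y^(2m)] = O(α^(-m))` by induction. A quadratic
test function, chosen so that `((1+Y)^ν - 1) g` is linear in `Y` up to fourth order, then gives
`E[Y] = -(ν-1)/(2ν)/α + O(α^(-2))` (`exists_abs_cmpMean_div_sub_one_add_le`). Hence `log Z` minus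
its main terms has derivative `O(lam^(-1/ν-1))`, so it converges with error `O(lam^(-1/ν))`. The
limit is found along integer `α = n`: the sum is the integral of a rescaled step function, which by
Stirling's formula and dominated convergence tends to the integral of `exp(-ν x²/2)`
(`tendsto_cmpLogRemainder_natCast_rpow`).

Part (b) is a termwise identity: one factor of the Poisson weight raises the exponent `ν - 1` to
`ν`.

For (c), solve `f' - x f = h - E h(N)`. The Stein identity at `ν = 1` turns `E h(W) - E h(N)`, with
`W` the standardised Poisson variable and `δ = 1/√α`, into `-√α E[f(W+δ) - f(W) - δ f'(W)]`.
Boundedness of `f''` gives the rate `α^(-1/2)`. If `h` is even, `f''` is odd, so `E f''(N) = 0`;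
applying the first rate to `f''` shows that the second-order Taylor term is smaller by another
factor `δ`. The derivatives of `f` are bounded by comparison with explicit barriers, since each
again solves a Stein equation. -/

/-! ### Functions of polynomial growth on `ℕ` -/

/-- `g : ℕ → ℝ` grows at most polynomially. -/
def PolyGrowth (g : ℕ → ℝ) : Prop :=
  ∃ (C : ℝ) (m : ℕ), ∀ k : ℕ, |g k| ≤ C * ((k : ℝ) + 1) ^ m

namespace PolyGrowth

variable {f g : ℕ → ℝ}

lemma of_le (hg : PolyGrowth g) (h : ∀ k, |f k| ≤ |g k|) : PolyGrowth f := by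
  obtain ⟨C, m, hC⟩ := hg
  exact ⟨C, m, fun k => (h k).trans (hC k)⟩

lemma exists_nonneg (hg : PolyGrowth g) :
    ∃ (C : ℝ) (m : ℕ), 0 ≤ C ∧ ∀ k : ℕ, |g k| ≤ C * ((k : ℝ) + 1) ^ m := by
  obtain ⟨C, m, hC⟩ := hg
  refine ⟨C, m, ?_, hC⟩
  have := (abs_nonneg _).trans (hC 0)
  simpa using this

lemma const (c : ℝ) : PolyGrowth (fun _ => c) := ⟨|c|, 0, fun _ => by simp⟩

lemma cast : PolyGrowth (fun k => (k : ℝ)) :=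
  ⟨1, 1, fun _ => by rw [abs_of_nonneg (Nat.cast_nonneg _)]; linarith⟩

lemma add (hf : PolyGrowth f) (hg : PolyGrowth g) : PolyGrowth (fun k => f k + g k) := by
  obtain ⟨C, m, hC0, hC⟩ := hf.exists_nonneg
  obtain ⟨D, n, hD0, hD⟩ := hg.exists_nonneg
  refine ⟨C + D, m + n, fun k => (abs_add_le _ _).trans ?_⟩
  have h1 : (1 : ℝ) ≤ (k : ℝ) + 1 := by linarith [Nat.cast_nonneg (α := ℝ) k]
  have hm : ((k : ℝ) + 1) ^ m ≤ ((k : ℝ) + 1) ^ (m + n) := pow_le_pow_right₀ h1 (by omega)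
  have hn : ((k : ℝ) + 1) ^ n ≤ ((k : ℝ) + 1) ^ (m + n) := pow_le_pow_right₀ h1 (by omega)
  rw [add_mul]
  exact add_le_add ((hC k).trans (by gcongr)) ((hD k).trans (by gcongr))

lemma mul (hf : PolyGrowth f) (hg : PolyGrowth g) : PolyGrowth (fun k => f k * g k) := by
  obtain ⟨C, m, hC0, hC⟩ := hf.exists_nonneg
  obtain ⟨D, n, hD0, hD⟩ := hg.exists_nonneg
  refine ⟨C * D, m + n, fun k => ?_⟩
  rw [abs_mul, pow_add]
  calc |f k| * |g k| ≤ (C * ((k : ℝ) + 1) ^ m) * (D * ((k : ℝ) + 1) ^ n) := by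
        gcongr
        · exact hC k
        · exact hD k
    _ = _ := by ring

lemma const_mul (c : ℝ) (hf : PolyGrowth f) : PolyGrowth (fun k => c * f k) := (const c).mul hf

lemma sub (hf : PolyGrowth f) (hg : PolyGrowth g) : PolyGrowth (fun k => f k - g k) := by
  refine (hf.add (hg.const_mul (-1))).of_le fun k => le_of_eq ?_
  congr 1; ring

lemma pow (hf : PolyGrowth f) (n : ℕ) : PolyGrowth (fun k => f k ^ n) := by
  induction n with
  | zero => simpa using const 1
  | succ n ih => simpa only [pow_succ] using ih.mul hf

lemma abs (hf : PolyGrowth f) : PolyGrowth (fun k => |f k|) :=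
  hf.of_le fun _ => (abs_abs _).le

lemma div_of_one_le (hf : PolyGrowth f) (hg : ∀ k, 1 ≤ g k) : PolyGrowth (fun k => f k / g k) := by
  refine hf.of_le fun k => ?_
  rw [abs_div, abs_of_pos (zero_lt_one.trans_le (hg k))]
  exact div_le_self (abs_nonneg _) (hg k)

lemma shift (hf : PolyGrowth f) : PolyGrowth (fun k => f (k + 1)) := by
  obtain ⟨C, m, hC0, hC⟩ := hf.exists_nonneg
  refine ⟨C * 2 ^ m, m, fun k => (hC (k + 1)).trans ?_⟩
  rw [mul_assoc, ← mul_pow]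
  have := Nat.cast_nonneg (α := ℝ) k
  gcongr
  push_cast; linarith

lemma rpow (hf : PolyGrowth f) (h0 : ∀ k, 0 ≤ f k) {ν : ℝ} (hν : 0 ≤ ν) :
    PolyGrowth (fun k => f k ^ ν) := by
  refine (((const 1).add hf).pow ⌈ν⌉₊).of_le fun k => ?_
  rw [abs_of_nonneg (Real.rpow_nonneg (h0 k) _)]
  refine le_trans ?_ (le_abs_self _)
  rw [← Real.rpow_natCast]
  have := h0 k
  calc f k ^ ν ≤ (1 + f k) ^ ν := Real.rpow_le_rpow this (by linarith) hν
    _ ≤ _ := Real.rpow_le_rpow_of_exponent_le (by linarith) (Nat.le_ceil ν)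

end PolyGrowth

/-! ### The Conway-Maxwell-Poisson expectation -/

/-- The unnormalized Conway-Maxwell-Poisson weights. -/
noncomputable def cmpWeight (ν α : ℝ) (k : ℕ) : ℝ := (α ^ k / (Nat.factorial k : ℝ)) ^ ν

/-- The expectation under the Conway-Maxwell-Poisson law with weights `cmpWeight ν α`. -/
noncomputable def cmpMean (ν α : ℝ) (g : ℕ → ℝ) : ℝ :=
  (∑' k, cmpWeight ν α k * g k) / ∑' k, cmpWeight ν α k

section cmpMean

variable {ν α : ℝ} {f g : ℕ → ℝ}

lemma cmpWeight_pos (hα : 0 < α) (k : ℕ) : 0 < cmpWeight ν α k := by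
  unfold cmpWeight; positivity

/-- The weight recursion behind both the ratio test and the Stein identity. -/
lemma cmpWeight_succ (hα : 0 < α) (k : ℕ) :
    cmpWeight ν α (k + 1) * (((k + 1 : ℕ) : ℝ) / α) ^ ν = cmpWeight ν α k := by
  unfold cmpWeight
  rw [← Real.mul_rpow (by positivity) (by positivity), Nat.factorial_succ]
  congr 1
  push_cast
  field_simp
  ring

lemma summable_cmpWeight_mul_pow (hν : 0 < ν) (hα : 0 < α) (m : ℕ) :
    Summable (fun k : ℕ => cmpWeight ν α k * ((k : ℝ) + 1) ^ m) := by
  refine summable_of_ratio_test_tendsto_lt_one (l := 0) zero_lt_one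
    (Eventually.of_forall fun k => (mul_pos (cmpWeight_pos hα k) (by positivity)).ne') ?_
  have hlim : Tendsto (fun k : ℕ => 2 ^ m * (α / ((k : ℝ) + 1)) ^ ν) atTop (nhds 0) := by
    have h1 : Tendsto (fun k : ℕ => α / ((k : ℝ) + 1)) atTop (nhds 0) :=
      tendsto_const_nhds.div_atTop
        (tendsto_atTop_add_const_right _ _ tendsto_natCast_atTop_atTop)
    have h2 := (h1.rpow_const (p := ν) (Or.inr hν.le)).const_mul (2 ^ m)
    simpa [Real.zero_rpow hν.ne'] using h2
  refine squeeze_zero (fun k => by positivity) (fun k => ?_) hlim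
  have hw := cmpWeight_pos (ν := ν) hα (k + 1)
  have hk : (0 : ℝ) < (k : ℝ) + 1 := by positivity
  rw [← cmpWeight_succ hα k, Real.norm_of_nonneg (by positivity),
    Real.norm_of_nonneg (by positivity), ← inv_div ((k : ℝ) + 1) α, Real.inv_rpow (by positivity)]
  push_cast
  have hp : 0 < (((k : ℝ) + 1) / α) ^ ν := by positivity
  have h3 : ((k : ℝ) + 1 + 1) ^ m ≤ 2 ^ m * ((k : ℝ) + 1) ^ m := by
    rw [← mul_pow]; gcongr; linarith
  rw [div_le_iff₀ (by positivity)]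
  calc _ ≤ cmpWeight ν α (k + 1) * (2 ^ m * ((k : ℝ) + 1) ^ m) := by gcongr
    _ = _ := by field_simp

lemma PolyGrowth.summable (hg : PolyGrowth g) (hν : 0 < ν) (hα : 0 < α) :
    Summable (fun k => cmpWeight ν α k * g k) := by
  obtain ⟨C, m, hC⟩ := hg
  refine Summable.of_norm_bounded ((summable_cmpWeight_mul_pow hν hα m).mul_left C) fun k => ?_
  rw [Real.norm_eq_abs, abs_mul, abs_of_pos (cmpWeight_pos hα k)]
  have := mul_le_mul_of_nonneg_left (hC k) (cmpWeight_pos (ν := ν) hα k).le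
  linarith

lemma summable_cmpWeight (hν : 0 < ν) (hα : 0 < α) : Summable (cmpWeight ν α) := by
  simpa using summable_cmpWeight_mul_pow hν hα 0

lemma tsum_cmpWeight_pos (hν : 0 < ν) (hα : 0 < α) : 0 < ∑' k, cmpWeight ν α k :=
  (summable_cmpWeight hν hα).tsum_pos (fun k => (cmpWeight_pos hα k).le) 0 (cmpWeight_pos hα 0)

lemma cmpMean_add (hν : 0 < ν) (hα : 0 < α) (hf : PolyGrowth f) (hg : PolyGrowth g) :
    cmpMean ν α (fun k => f k + g k) = cmpMean ν α f + cmpMean ν α g := by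
  unfold cmpMean
  simp only [mul_add]
  rw [(hf.summable hν hα).tsum_add (hg.summable hν hα), add_div]

lemma cmpMean_const_mul (c : ℝ) (f : ℕ → ℝ) :
    cmpMean ν α (fun k => c * f k) = c * cmpMean ν α f := by
  unfold cmpMean
  simp only [mul_left_comm _ c]
  rw [tsum_mul_left, mul_div_assoc]

lemma cmpMean_sub (hν : 0 < ν) (hα : 0 < α) (hf : PolyGrowth f) (hg : PolyGrowth g) :
    cmpMean ν α (fun k => f k - g k) = cmpMean ν α f - cmpMean ν α g := by
  unfold cmpMean
  simp only [mul_sub]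
  rw [(hf.summable hν hα).tsum_sub (hg.summable hν hα), sub_div]

lemma cmpMean_const (hν : 0 < ν) (hα : 0 < α) (c : ℝ) : cmpMean ν α (fun _ => c) = c := by
  unfold cmpMean
  rw [tsum_mul_right, mul_div_cancel_left₀ _ (tsum_cmpWeight_pos hν hα).ne']

lemma cmpMean_mono (hν : 0 < ν) (hα : 0 < α) (hf : PolyGrowth f) (hg : PolyGrowth g)
    (h : ∀ k, f k ≤ g k) : cmpMean ν α f ≤ cmpMean ν α g := by
  unfold cmpMean
  have := tsum_cmpWeight_pos hν hα
  gcongr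
  · exact hf.summable hν hα
  · exact hg.summable hν hα
  · exact (cmpWeight_pos hα _).le
  · exact h _

lemma cmpMean_nonneg (hν : 0 < ν) (hα : 0 < α) (h : ∀ k, 0 ≤ f k) : 0 ≤ cmpMean ν α f :=
  div_nonneg (tsum_nonneg fun k => mul_nonneg (cmpWeight_pos hα k).le (h k))
    (tsum_cmpWeight_pos hν hα).le

lemma abs_cmpMean_le (hν : 0 < ν) (hα : 0 < α) (hf : PolyGrowth f) (hg : PolyGrowth g)
    (h : ∀ k, |f k| ≤ g k) : |cmpMean ν α f| ≤ cmpMean ν α g := by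
  rw [abs_le]
  constructor
  · have := cmpMean_mono hν hα (hg.const_mul (-1)) hf fun k => by linarith [(abs_le.1 (h k)).1]
    rw [cmpMean_const_mul] at this
    linarith
  · exact cmpMean_mono hν hα hf hg fun k => (abs_le.1 (h k)).2

/-- The Stein identity of the Conway-Maxwell-Poisson law. -/
lemma cmpMean_rpow_mul (hν : 0 < ν) (hα : 0 < α) (hg : PolyGrowth g) :
    cmpMean ν α (fun k => ((k : ℝ) / α) ^ ν * g k) = cmpMean ν α (fun k => g (k + 1)) := by
  unfold cmpMean
  have hs : PolyGrowth (fun k => ((k : ℝ) / α) ^ ν * g k) := by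
    refine PolyGrowth.mul (PolyGrowth.rpow ?_ (fun k => by positivity) hν.le) hg
    simpa only [div_eq_inv_mul] using PolyGrowth.cast.const_mul α⁻¹
  -- The term `k = 0` vanishes because `0 ^ ν = 0`; in the others the factor turns the weight at `k
  -- + 1` into the weight at `k`.
  rw [(hs.summable hν hα).tsum_eq_zero_add]
  simp only [CharP.cast_eq_zero, zero_div, Real.zero_rpow hν.ne', zero_mul, mul_zero, zero_add,
    ← mul_assoc, cmpWeight_succ hα]

end cmpMean

/-! ### Real powers near one -/

/-- Coercivity for the moment recursion. Dividing by `1 + |t - 1|` leaves only linear growth, which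
is what allows all `ν > 0` at once. For `t ≤ 1` and `ν ≤ 1` this is Bernoulli's inequality; for `t ≥
1` the denominator equals `t`, and Bernoulli is applied at `1/t`. -/
lemma min_one_mul_le_rpow_sub_one_mul {ν : ℝ} (hν : 0 < ν) {t : ℝ} (ht : 0 ≤ t) :
    min 1 ν * ((t - 1) ^ 2 / (1 + |t - 1|)) ≤ (t ^ ν - 1) * (t - 1) := by
  have hsq : (t - 1) ^ 2 / (1 + |t - 1|) ≤ (t - 1) ^ 2 :=
    div_le_self (sq_nonneg _) (by linarith [abs_nonneg (t - 1)])
  have h0 : 0 ≤ (t - 1) ^ 2 / (1 + |t - 1|) := by positivity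
  rcases le_total t 1 with h1 | h1
  · have key : t ^ ν ≤ 1 + min 1 ν * (t - 1) := by
      rcases le_total 1 ν with h | h
      · rw [min_eq_left h]
        have := Real.rpow_le_rpow_of_exponent_ge' ht h1 zero_le_one h
        rw [Real.rpow_one] at this
        linarith
      · rw [min_eq_right h]
        have := rpow_one_add_le_one_add_mul_self (s := t - 1) (by linarith) hν.le h
        simpa using this
    calc min 1 ν * ((t - 1) ^ 2 / (1 + |t - 1|)) ≤ min 1 ν * (t - 1) ^ 2 := by gcongr
      _ ≤ _ := by nlinarith
  · have key : 1 + min 1 ν * ((t - 1) / t) ≤ t ^ ν := by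
      have htp : 0 < t := by linarith
      have hq : (t - 1) / t ≤ t - 1 := div_le_self (by linarith) h1
      rcases le_total 1 ν with h | h
      · rw [min_eq_left h]
        have := Real.rpow_le_rpow_of_exponent_le h1 h
        rw [Real.rpow_one] at this
        linarith
      · rw [min_eq_right h]
        have h2 := rpow_one_add_le_one_add_mul_self (s := t⁻¹ - 1)
          (by linarith [inv_pos.2 htp]) hν.le h
        rw [add_sub_cancel, Real.inv_rpow ht] at h2
        have hz : 0 ≤ (t - 1) / t := div_nonneg (by linarith) ht
        have h3 : 1 + ν * (t⁻¹ - 1) = 1 - ν * ((t - 1) / t) := by field_simp; ring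
        rw [h3] at h2
        have hp : 0 < t ^ ν := by positivity
        have h4 : 1 ≤ (1 - ν * ((t - 1) / t)) * t ^ ν := by
          calc (1 : ℝ) = (t ^ ν)⁻¹ * t ^ ν := by field_simp
            _ ≤ _ := by gcongr
        have h5 : 1 ≤ t ^ ν := Real.one_le_rpow h1 hν.le
        nlinarith [mul_nonneg hν.le hz]
    have e : (t - 1) ^ 2 / (1 + |t - 1|) = ((t - 1) / t) * (t - 1) := by
      rw [abs_of_nonneg (by linarith)]; field_simp; ring
    rw [e, ← mul_assoc]
    exact mul_le_mul_of_nonneg_right (by linarith) (by linarith)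

lemma exists_isBigO_one_add_rpow (ν : ℝ) :
    ∃ c : ℝ, (fun y : ℝ => (1 + y) ^ ν - (1 + ν * y + ν * (ν - 1) / 2 * y ^ 2 + c * y ^ 3))
      =O[nhds 0] fun y => y ^ 4 := by
  refine ⟨Ring.choose ν 3, ?_⟩
  have h := (Real.one_add_rpow_hasFPowerSeriesAt_zero (a := ν)).isBigO_sub_partialSum_pow 4
  have h2 : Ring.choose ν 2 = ν * (ν - 1) / 2 := by
    have := Ring.descPochhammer_eq_factorial_smul_choose ν 2
    simp [descPochhammer_succ_right, Polynomial.smeval_mul, Polynomial.smeval_sub,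
      Polynomial.smeval_X, Polynomial.smeval_one] at this
    linarith
  refine (h.congr (fun y => ?_) (fun y => ?_))
  · simp [FormalMultilinearSeries.partialSum, Finset.sum_range_succ, binomialSeries,
      FormalMultilinearSeries.coeff_ofScalars, h2]
    ring
  · rw [Real.norm_eq_abs, Even.pow_abs (by decide)]

/-- Supplies the test function for the mean: the quadratic factor cancels the second- and
third-order terms of `t ^ ν - 1` at `t = 1`. Near `1` the error is a Taylor remainder; away from `1`
polynomial growth suffices, as `(t - 1) ^ 4` is bounded below there. -/
lemma exists_abs_rpow_mul_quadratic_le {ν : ℝ} (hν : 0 < ν) :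
    ∃ (b C : ℝ) (n : ℕ), 0 ≤ C ∧ ∀ t : ℝ, 0 ≤ t →
      |(t ^ ν - 1) * (1 - (ν - 1) / 2 * (t - 1) + b * (t - 1) ^ 2) - ν * (t - 1)| ≤
        C * ((t - 1) ^ 4 * (1 + |t - 1|) ^ n) := by
  obtain ⟨c, hc⟩ := exists_isBigO_one_add_rpow ν
  set a : ℝ := (ν - 1) / 2 with ha
  -- The cubic coefficient of the product is `c - a * (ν * a) + b * ν`; this `b` makes it zero.
  set b : ℝ := (a * (ν * a) - c) / ν with hb
  have hbν : b * ν = a * (ν * a) - c := by rw [hb]; field_simp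
  obtain ⟨D, hD⟩ := hc.bound
  rw [Metric.eventually_nhds_iff] at hD
  obtain ⟨r, hr, hD⟩ := hD
  -- `⌈ν⌉₊` accounts for the growth of the real power, `2` for the quadratic factor.
  set n : ℕ := ⌈ν⌉₊ + 2 with hn
  have hD0 : 0 ≤ D := by
    have h1 := hD (y := r / 2) (by rw [Real.dist_eq, sub_zero, abs_of_pos] <;> linarith)
    have h2 : 0 < ‖(r / 2) ^ 4‖ := norm_pos_iff.2 (by positivity)
    by_contra hneg
    push Not at hneg
    nlinarith [norm_nonneg ((1 + r / 2) ^ ν - (1 + ν * (r / 2) + ν * (ν - 1) / 2 * (r / 2) ^ 2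
      + c * (r / 2) ^ 3))]
  set K : ℝ := 1 + |a| + |b| with hK
  set C₁ : ℝ := |-a * c + b * (ν * a)| + |b * c| + D * K with hC1
  set C₂ : ℝ := (2 * K + ν) / r ^ 4 with hC2
  have hC1' : 0 ≤ C₁ := by positivity
  have hC2' : 0 ≤ C₂ := by positivity
  refine ⟨b, C₁ + C₂, n, by positivity, fun t ht => ?_⟩
  obtain ⟨y, rfl⟩ : ∃ y, t = 1 + y := ⟨t - 1, by ring⟩
  simp only [add_sub_cancel_left]
  have hy1 : 1 ≤ 1 + |y| := by linarith [abs_nonneg y]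
  have hq : |1 - a * y + b * y ^ 2| ≤ K * (1 + |y|) ^ 2 := by
    calc |1 - a * y + b * y ^ 2| ≤ |1 - a * y| + |b * y ^ 2| := abs_add_le _ _
      _ ≤ (|1| + |a * y|) + |b * y ^ 2| := by gcongr; exact abs_sub _ _
      _ = 1 + |a| * |y| + |b| * |y| ^ 2 := by rw [abs_one, abs_mul, abs_mul, abs_pow]
      _ ≤ K * (1 + |y|) ^ 2 := by
        rw [hK]
        nlinarith [abs_nonneg a, abs_nonneg b, abs_nonneg y, mul_nonneg (abs_nonneg a) (abs_nonneg y),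
          mul_nonneg (abs_nonneg a) (sq_nonneg |y|), mul_nonneg (abs_nonneg b) (abs_nonneg y),
          sq_nonneg |y|]
  have hpow2 : (1 + |y|) ^ 2 ≤ (1 + |y|) ^ n := pow_le_pow_right₀ hy1 (by omega)
  have hpow1 : 1 + |y| ≤ (1 + |y|) ^ n := by
    simpa using pow_le_pow_right₀ hy1 (show 1 ≤ n by omega)
  have hy4 : 0 ≤ y ^ 4 := by positivity
  rcases lt_or_ge |y| r with hlt | hge
  · have h1 := hD (y := y) (by rwa [Real.dist_eq, sub_zero])
    set ρ := (1 + y) ^ ν - (1 + ν * y + ν * (ν - 1) / 2 * y ^ 2 + c * y ^ 3) with hρ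
    rw [Real.norm_eq_abs, Real.norm_eq_abs, abs_of_nonneg hy4] at h1
    have e : ((1 + y) ^ ν - 1) * (1 - a * y + b * y ^ 2) - ν * y =
        (-a * c + b * (ν * a)) * y ^ 4 + b * c * y ^ 5 + ρ * (1 - a * y + b * y ^ 2) := by
      have e1 : (1 + y) ^ ν = ρ + (1 + ν * y + ν * a * y ^ 2 + c * y ^ 3) := by
        rw [hρ, ha]; ring
      rw [e1]
      linear_combination y ^ 3 * hbν
    rw [e]
    calc _ ≤ |(-a * c + b * (ν * a)) * y ^ 4 + b * c * y ^ 5| + |ρ * (1 - a * y + b * y ^ 2)| :=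
          abs_add_le _ _
      _ ≤ (|(-a * c + b * (ν * a)) * y ^ 4| + |b * c * y ^ 5|)
          + |ρ| * |1 - a * y + b * y ^ 2| := by
        rw [abs_mul ρ]; gcongr; exact abs_add_le _ _
      _ = |-a * c + b * (ν * a)| * y ^ 4 + |b * c| * (y ^ 4 * |y|)
          + |ρ| * |1 - a * y + b * y ^ 2| := by
        rw [abs_mul _ (y ^ 4), abs_mul _ (y ^ 5), abs_of_nonneg hy4, pow_succ y 4, abs_mul (y ^ 4),
          abs_of_nonneg hy4]
      _ ≤ |-a * c + b * (ν * a)| * (y ^ 4 * (1 + |y|) ^ n) + |b * c| * (y ^ 4 * (1 + |y|) ^ n)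
          + (D * y ^ 4) * (K * (1 + |y|) ^ n) := by
        gcongr
        · exact le_mul_of_one_le_right hy4 (by linarith)
        · linarith
        · exact hq.trans (by gcongr)
      _ = C₁ * (y ^ 4 * (1 + |y|) ^ n) := by rw [hC1]; ring
      _ ≤ _ := by gcongr; linarith
  · have h1 : |(1 + y) ^ ν - 1| ≤ 2 * (1 + |y|) ^ ⌈ν⌉₊ := by
      have hp : (1 + y) ^ ν ≤ (1 + |y|) ^ ⌈ν⌉₊ := by
        rw [← Real.rpow_natCast]
        calc (1 + y) ^ ν ≤ (1 + |y|) ^ ν :=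
              Real.rpow_le_rpow ht (by linarith [le_abs_self y]) hν.le
          _ ≤ _ := Real.rpow_le_rpow_of_exponent_le hy1 (Nat.le_ceil ν)
      have h1 : 1 ≤ (1 + |y|) ^ ⌈ν⌉₊ := one_le_pow₀ hy1
      rw [abs_le]
      constructor <;> linarith [Real.rpow_nonneg ht ν]
    have hr4 : 1 ≤ y ^ 4 / r ^ 4 := by
      rw [one_le_div (by positivity), ← Even.pow_abs (by decide) y]
      gcongr
    calc _ ≤ |((1 + y) ^ ν - 1) * (1 - a * y + b * y ^ 2)| + |ν * y| := abs_sub _ _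
      _ ≤ (2 * (1 + |y|) ^ ⌈ν⌉₊) * (K * (1 + |y|) ^ 2) + ν * (1 + |y|) ^ n := by
        rw [abs_mul, abs_mul, abs_of_pos hν]
        gcongr
        linarith
      _ = (2 * K + ν) * (1 + |y|) ^ n := by rw [hn, pow_add]; ring
      _ = (2 * K + ν) * (1 * (1 + |y|) ^ n) := by ring
      _ ≤ (2 * K + ν) * (y ^ 4 / r ^ 4 * (1 + |y|) ^ n) := by gcongr
      _ = C₂ * (y ^ 4 * (1 + |y|) ^ n) := by rw [hC2]; ring
      _ ≤ _ := by gcongr; linarith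

/-! ### Moments of the Conway-Maxwell-Poisson law -/

section moments

variable {ν α : ℝ}

lemma polyGrowth_div_sub_one (α : ℝ) : PolyGrowth (fun k => (k : ℝ) / α - 1) := by
  refine PolyGrowth.sub ?_ (PolyGrowth.const 1)
  simpa only [div_eq_inv_mul] using PolyGrowth.cast.const_mul α⁻¹

lemma polyGrowth_div_rpow (hν : 0 < ν) (hα : 0 < α) :
    PolyGrowth (fun k => ((k : ℝ) / α) ^ ν) := by
  refine PolyGrowth.rpow ?_ (fun k => by positivity) hν.le
  simpa only [div_eq_inv_mul] using PolyGrowth.cast.const_mul α⁻¹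

lemma polyGrowth_pow_div_one_add_abs (α : ℝ) (m : ℕ) :
    PolyGrowth (fun k => ((k : ℝ) / α - 1) ^ m / (1 + |(k : ℝ) / α - 1|)) :=
  ((polyGrowth_div_sub_one α).pow m).div_of_one_le fun k => by
    linarith [abs_nonneg ((k : ℝ) / α - 1)]

lemma cmpMean_rpow_sub_one_mul (hν : 0 < ν) (hα : 0 < α) {g : ℕ → ℝ} (hg : PolyGrowth g) :
    cmpMean ν α (fun k => (((k : ℝ) / α) ^ ν - 1) * g k) =
      cmpMean ν α (fun k => g (k + 1) - g k) := by
  rw [cmpMean_sub hν hα hg.shift hg, ← cmpMean_rpow_mul hν hα hg,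
    ← cmpMean_sub hν hα ((polyGrowth_div_rpow hν hα).mul hg) hg]
  congr 1; ext k; ring

/-- Bounds the right side of the Stein identity for the test function `Y ^ (2m+1)`. Only even powers
remain, so the recursion closes on even moments. -/
lemma add_pow_sub_pow_le {y δ : ℝ} (hδ : 0 ≤ δ) (m : ℕ) :
    (y + δ) ^ (2 * m + 1) - y ^ (2 * m + 1) ≤
      (2 * m + 1) * 2 ^ (2 * m) * δ * (y ^ (2 * m) + δ ^ (2 * m)) := by
  have h := (le_abs_self _).trans (abs_pow_sub_pow_le (a := y + δ) (b := y) (n := 2 * m + 1))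
  rw [add_sub_cancel_left, abs_of_nonneg hδ, Nat.add_sub_cancel] at h
  have h1 : max |y + δ| |y| ≤ |y| + δ :=
    max_le ((abs_add_le _ _).trans (by rw [abs_of_nonneg hδ])) (by linarith)
  have h2 : (|y| + δ) ^ (2 * m) ≤ 2 ^ (2 * m) * (y ^ (2 * m) + δ ^ (2 * m)) := by
    refine (add_pow_le (abs_nonneg y) hδ _).trans ?_
    rw [Even.pow_abs (even_two_mul m)]
    have : 0 ≤ y ^ (2 * m) := (even_two_mul m).pow_nonneg y
    gcongr
    · norm_num
    · omega
  calc _ ≤ δ * ((2 * m + 1 : ℕ) : ℝ) * max |y + δ| |y| ^ (2 * m) := h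
    _ ≤ δ * ((2 * m + 1 : ℕ) : ℝ) * (2 ^ (2 * m) * (y ^ (2 * m) + δ ^ (2 * m))) := by
      gcongr
      exact (pow_le_pow_left₀ (le_max_of_le_left (abs_nonneg _)) h1 _).trans h2
    _ = _ := by push_cast; ring

/-- Follows from `1 + |y| ≤ 2 (1 + y²)`; returns from damped moments to plain ones at the price of
the next damped moment. -/
lemma pow_le_pow_div_one_add_abs (y : ℝ) (m : ℕ) :
    y ^ (2 * m) ≤ 2 * (y ^ (2 * m) / (1 + |y|) + y ^ (2 * (m + 1)) / (1 + |y|)) := by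
  have h1 : 0 < 1 + |y| := by positivity
  have h0 : 0 ≤ y ^ (2 * m) := (even_two_mul m).pow_nonneg y
  rw [← add_div, mul_div_assoc', le_div_iff₀ h1, mul_add 2 m 1, pow_add]
  have h2 : 1 + |y| ≤ 2 * (1 + y ^ (2 * 1)) := by
    rw [mul_one, ← sq_abs y]; nlinarith [sq_nonneg (|y| - 1), sq_nonneg |y|]
  nlinarith

lemma cmpMean_pow_le_pow_div (hν : 0 < ν) (hα : 0 < α) (m : ℕ) :
    cmpMean ν α (fun k => ((k : ℝ) / α - 1) ^ (2 * m)) ≤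
      2 * (cmpMean ν α (fun k => ((k : ℝ) / α - 1) ^ (2 * m) / (1 + |(k : ℝ) / α - 1|)) +
        cmpMean ν α (fun k => ((k : ℝ) / α - 1) ^ (2 * (m + 1)) / (1 + |(k : ℝ) / α - 1|))) := by
  have p1 := polyGrowth_pow_div_one_add_abs α (2 * m)
  have p2 := polyGrowth_pow_div_one_add_abs α (2 * (m + 1))
  rw [← cmpMean_add hν hα p1 p2, ← cmpMean_const_mul]
  exact cmpMean_mono hν hα ((polyGrowth_div_sub_one α).pow _) ((p1.add p2).const_mul 2)
    fun k => pow_le_pow_div_one_add_abs _ m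

/-- The Stein identity for `Y ^ (2m+1)`, with coercivity on the left and the increment bound on the
right. Each step gains a factor `1/α`. -/
lemma cmpMean_pow_div_le_succ (hν : 0 < ν) (hα : 0 < α) (m : ℕ) :
    min 1 ν *
      cmpMean ν α (fun k => ((k : ℝ) / α - 1) ^ (2 * (m + 1)) / (1 + |(k : ℝ) / α - 1|)) ≤
      (2 * m + 1) * 2 ^ (2 * m) * (1 / α) *
        (cmpMean ν α (fun k => ((k : ℝ) / α - 1) ^ (2 * m)) + (1 / α) ^ (2 * m)) := by
  have pY := polyGrowth_div_sub_one α
  have hδ : 0 ≤ 1 / α := by positivity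
  have hshift : ∀ k : ℕ, ((k + 1 : ℕ) : ℝ) / α - 1 = ((k : ℝ) / α - 1) + 1 / α := fun k => by
    push_cast; ring
  calc _ = cmpMean ν α (fun k => min 1 ν *
          (((k : ℝ) / α - 1) ^ (2 * (m + 1)) / (1 + |(k : ℝ) / α - 1|))) := by
        rw [cmpMean_const_mul]
    _ ≤ cmpMean ν α (fun k => (((k : ℝ) / α) ^ ν - 1) * ((k : ℝ) / α - 1) ^ (2 * m + 1)) := by
        refine cmpMean_mono hν hα ((polyGrowth_pow_div_one_add_abs α _).const_mul _)
          (((polyGrowth_div_rpow hν hα).sub (PolyGrowth.const 1)).mul (pY.pow _)) fun k => ?_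
        have h := min_one_mul_le_rpow_sub_one_mul hν (t := (k : ℝ) / α) (by positivity)
        have h0 : 0 ≤ ((k : ℝ) / α - 1) ^ (2 * m) := (even_two_mul m).pow_nonneg _
        have h2 := mul_le_mul_of_nonneg_right h h0
        calc _ = min 1 ν * (((k : ℝ) / α - 1) ^ 2 / (1 + |(k : ℝ) / α - 1|)) *
              ((k : ℝ) / α - 1) ^ (2 * m) := by ring
          _ ≤ _ := h2
          _ = _ := by ring
    _ = cmpMean ν α (fun k => (((k + 1 : ℕ) : ℝ) / α - 1) ^ (2 * m + 1) -
          ((k : ℝ) / α - 1) ^ (2 * m + 1)) :=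
        cmpMean_rpow_sub_one_mul hν hα (pY.pow (2 * m + 1))
    _ ≤ cmpMean ν α (fun k => (2 * m + 1) * 2 ^ (2 * m) * (1 / α) *
          (((k : ℝ) / α - 1) ^ (2 * m) + (1 / α) ^ (2 * m))) := by
        refine cmpMean_mono hν hα (((pY.pow (2 * m + 1)).shift).sub (pY.pow _))
          (((pY.pow _).add (PolyGrowth.const _)).const_mul _) fun k => ?_
        rw [hshift]
        exact add_pow_sub_pow_le hδ m
    _ = _ := by
        rw [cmpMean_const_mul, cmpMean_add hν hα (pY.pow _) (PolyGrowth.const _),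
          cmpMean_const hν hα]

lemma exists_cmpMean_pow_div_le (hν : 0 < ν) (m : ℕ) :
    ∃ C A : ℝ, 0 ≤ C ∧ 1 ≤ A ∧ ∀ α, A ≤ α →
      cmpMean ν α (fun k => ((k : ℝ) / α - 1) ^ (2 * m) / (1 + |(k : ℝ) / α - 1|)) ≤
        C * (1 / α) ^ m := by
  induction m with
  | zero =>
    refine ⟨1, 1, zero_le_one, le_rfl, fun α hα => ?_⟩
    have hα0 : 0 < α := by linarith
    refine (cmpMean_mono hν hα0 (polyGrowth_pow_div_one_add_abs α _) (PolyGrowth.const 1)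
      fun k => ?_).trans ?_
    · rw [mul_zero, pow_zero]
      exact div_le_one_of_le₀ (by linarith [abs_nonneg ((k : ℝ) / α - 1)]) (by positivity)
    · rw [cmpMean_const hν hα0]; simp
  | succ m ih =>
    obtain ⟨C, A, hC, hA, h⟩ := ih
    set c := min 1 ν with hc
    have hc0 : 0 < c := lt_min one_pos hν
    set K : ℝ := (2 * m + 1) * 2 ^ (2 * m) with hK
    have hK0 : 0 < K := by positivity
    -- The plain moment on the right of the recursion involves the unknown moment `B` itself. For `α
    -- ≥ 4K/c` its coefficient `2Kδ` is at most `c/2`, so it is absorbed on the left.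
    refine ⟨2 * K / c * (2 * C + 1), max A (4 * K / c), by positivity, le_max_of_le_left hA,
      fun α hα => ?_⟩
    have hαA : A ≤ α := (le_max_left _ _).trans hα
    have hα1 : 1 ≤ α := hA.trans hαA
    have hα0 : 0 < α := by linarith
    have hαK : 4 * K / c ≤ α := (le_max_right _ _).trans hα
    set δ := 1 / α with hδ
    have hδ0 : 0 < δ := by positivity
    have hδ1 : δ ≤ 1 := by rw [hδ, div_le_one hα0]; exact hα1
    have hKδ : 4 * (K * δ) ≤ c := by
      rw [div_le_iff₀ hc0] at hαK
      rw [hδ, mul_one_div, mul_div_assoc', div_le_iff₀ hα0]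
      linarith
    have h1 := cmpMean_pow_div_le_succ hν hα0 m
    have h2 := cmpMean_pow_le_pow_div hν hα0 m
    have h3 := h α hαA
    rw [← hδ, ← hc, ← hK] at h1
    rw [← hδ] at h3
    set B := cmpMean ν α (fun k => ((k : ℝ) / α - 1) ^ (2 * (m + 1)) / (1 + |(k : ℝ) / α - 1|))
    have hB : 0 ≤ B := cmpMean_nonneg hν hα0 fun k =>
      div_nonneg ((even_two_mul _).pow_nonneg _) (by positivity)
    have h4 : δ ^ (2 * m) ≤ δ ^ m := pow_le_pow_of_le_one hδ0.le hδ1 (by omega)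
    have h5 : c * B ≤ K * δ * (2 * (C * δ ^ m + B) + δ ^ m) := h1.trans (by gcongr; linarith)
    have h6 : 2 * (K * δ) * B ≤ c / 2 * B := by gcongr; linarith
    have h7 : c * B ≤ 2 * (K * δ) * (2 * C + 1) * δ ^ m := by nlinarith
    calc B = c * B / c := by field_simp
      _ ≤ 2 * (K * δ) * (2 * C + 1) * δ ^ m / c := by gcongr
      _ = _ := by rw [pow_succ]; ring

lemma exists_cmpMean_pow_le (hν : 0 < ν) (m : ℕ) :
    ∃ C A : ℝ, 0 ≤ C ∧ 1 ≤ A ∧ ∀ α, A ≤ α →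
      cmpMean ν α (fun k => ((k : ℝ) / α - 1) ^ (2 * m)) ≤ C * (1 / α) ^ m := by
  obtain ⟨C, A, hC, hA, h⟩ := exists_cmpMean_pow_div_le hν m
  obtain ⟨D, B, hD, hB, h'⟩ := exists_cmpMean_pow_div_le hν (m + 1)
  refine ⟨2 * (C + D), max A B, by positivity, le_max_of_le_left hA, fun α hα => ?_⟩
  have hα1 : 1 ≤ α := hA.trans ((le_max_left _ _).trans hα)
  have hα0 : 0 < α := by linarith
  have h1 := h α ((le_max_left _ _).trans hα)
  have h2 := h' α ((le_max_right _ _).trans hα)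
  have h3 := cmpMean_pow_le_pow_div hν hα0 m
  have h4 : (1 / α) ^ (m + 1) ≤ (1 / α) ^ m :=
    pow_le_pow_of_le_one (by positivity) (by rw [div_le_one hα0]; exact hα1) (by omega)
  have h5 := mul_le_mul_of_nonneg_left h4 hD
  linarith

lemma exists_cmpMean_pow_four_mul_le (hν : 0 < ν) (n : ℕ) :
    ∃ C A : ℝ, 0 ≤ C ∧ 1 ≤ A ∧ ∀ α, A ≤ α →
      cmpMean ν α (fun k => ((k : ℝ) / α - 1) ^ 4 * (1 + |(k : ℝ) / α - 1|) ^ n) ≤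
        C * (1 / α) ^ 2 := by
  obtain ⟨C, A, hC, hA, h⟩ := exists_cmpMean_pow_le hν 2
  obtain ⟨D, B, hD, hB, h'⟩ := exists_cmpMean_pow_le hν (n + 2)
  refine ⟨2 ^ (2 * n) * (C + D), max A B, by positivity, le_max_of_le_left hA, fun α hα => ?_⟩
  have hα1 : 1 ≤ α := hA.trans ((le_max_left _ _).trans hα)
  have hα0 : 0 < α := by linarith
  have h1 := h α ((le_max_left _ _).trans hα)
  have h2 := h' α ((le_max_right _ _).trans hα)
  have pY := polyGrowth_div_sub_one α
  have h4 : (1 / α) ^ (n + 2) ≤ (1 / α) ^ 2 :=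
    pow_le_pow_of_le_one (by positivity) (by rw [div_le_one hα0]; exact hα1) (by omega)
  have h5 := mul_le_mul_of_nonneg_left h4 hD
  calc _ ≤ cmpMean ν α (fun k => 2 ^ (2 * n) *
        (((k : ℝ) / α - 1) ^ (2 * 2) + ((k : ℝ) / α - 1) ^ (2 * (n + 2)))) := by
        refine cmpMean_mono hν hα0 ((pY.pow 4).mul (((PolyGrowth.const 1).add pY.abs).pow n))
          (((pY.pow _).add (pY.pow _)).const_mul _) fun k => ?_
        set y := (k : ℝ) / α - 1
        -- The exponent is doubled so that the resulting power of `|y|` is even, leaving moments of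
        -- orders `4` and `2n + 4`.
        have e1 : (1 + |y|) ^ n ≤ (1 + |y|) ^ (2 * n) :=
          pow_le_pow_right₀ (by linarith [abs_nonneg y]) (by omega)
        have e2 := add_pow_le zero_le_one (abs_nonneg y) (2 * n)
        rw [one_pow, Even.pow_abs (even_two_mul n)] at e2
        have e0 : 0 ≤ y ^ (2 * n) := (even_two_mul n).pow_nonneg _
        have e3 : (2 : ℝ) ^ (2 * n - 1) * (1 + y ^ (2 * n)) ≤ 2 ^ (2 * n) * (1 + y ^ (2 * n)) := by
          gcongr
          · norm_num
          · omega
        calc y ^ 4 * (1 + |y|) ^ n ≤ y ^ 4 * (2 ^ (2 * n) * (1 + y ^ (2 * n))) := by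
              gcongr; linarith
          _ = _ := by ring
    _ = 2 ^ (2 * n) * (cmpMean ν α (fun k => ((k : ℝ) / α - 1) ^ (2 * 2)) +
          cmpMean ν α (fun k => ((k : ℝ) / α - 1) ^ (2 * (n + 2)))) := by
        rw [cmpMean_const_mul, cmpMean_add hν hα0 (pY.pow _) (pY.pow _)]
    _ ≤ _ := by
        rw [mul_assoc]
        gcongr
        linarith

/-- For `g = 1 - aY + bY²` the left side of the Stein identity is `ν E[Y] + O(α^(-2))`, and the
right side is explicit and affine in `E[Y]`. Solving for `E[Y]` gives the expansion. -/
lemma exists_abs_cmpMean_div_sub_one_add_le (hν : 0 < ν) :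
    ∃ C A : ℝ, 0 ≤ C ∧ 1 ≤ A ∧ ∀ α, A ≤ α →
      |cmpMean ν α (fun k => (k : ℝ) / α - 1) + (ν - 1) / (2 * ν) * (1 / α)| ≤
        C * (1 / α) ^ 2 := by
  obtain ⟨b, D, n, hD, hR⟩ := exists_abs_rpow_mul_quadratic_le hν
  obtain ⟨C, A, hC, hA, h⟩ := exists_cmpMean_pow_four_mul_le hν n
  set a := (ν - 1) / 2 with ha
  set c := (ν - 1) / (2 * ν) with hc
  have hac : a = ν * c := by rw [ha, hc]; field_simp
  refine ⟨2 / ν * (|b| + D * C + |2 * b * c|), max A (4 * |b| / ν), by positivity,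
    le_max_of_le_left hA, fun α hα => ?_⟩
  have hαA : A ≤ α := (le_max_left _ _).trans hα
  have hα1 : 1 ≤ α := hA.trans hαA
  have hα0 : 0 < α := by linarith
  have hαb : 4 * |b| / ν ≤ α := (le_max_right _ _).trans hα
  have pY := polyGrowth_div_sub_one α
  have p4 : PolyGrowth fun k : ℕ => ((k : ℝ) / α - 1) ^ 4 * (1 + |(k : ℝ) / α - 1|) ^ n :=
    (pY.pow 4).mul (((PolyGrowth.const 1).add pY.abs).pow n)
  set δ := 1 / α with hδ
  have hδ0 : 0 < δ := by positivity
  have hbδ : 4 * (|b| * δ) ≤ ν := by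
    rw [div_le_iff₀ hν] at hαb
    rw [hδ, mul_one_div, mul_div_assoc', div_le_iff₀ hα0]
    linarith
  set M := cmpMean ν α (fun k => (k : ℝ) / α - 1) with hM
  have pg : PolyGrowth fun k : ℕ =>
      1 - a * ((k : ℝ) / α - 1) + b * ((k : ℝ) / α - 1) ^ 2 :=
    ((PolyGrowth.const 1).sub (pY.const_mul a)).add ((pY.pow 2).const_mul b)
  have pT := ((polyGrowth_div_rpow hν hα0).sub (PolyGrowth.const 1)).mul pg
  have h1 : cmpMean ν α (fun k => (((k : ℝ) / α) ^ ν - 1) *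
      (1 - a * ((k : ℝ) / α - 1) + b * ((k : ℝ) / α - 1) ^ 2)) =
      -a * δ + b * (2 * δ * M + δ ^ 2) := by
    rw [cmpMean_rpow_sub_one_mul hν hα0 pg]
    have : (fun k : ℕ => (1 - a * (((k + 1 : ℕ) : ℝ) / α - 1)
        + b * (((k + 1 : ℕ) : ℝ) / α - 1) ^ 2) -
        (1 - a * ((k : ℝ) / α - 1) + b * ((k : ℝ) / α - 1) ^ 2)) =
        fun k : ℕ => (2 * b * δ) * ((k : ℝ) / α - 1) + (-a * δ + b * δ ^ 2) := by
      ext k; rw [hδ]; push_cast; ring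
    rw [this, cmpMean_add hν hα0 (pY.const_mul _) (PolyGrowth.const _), cmpMean_const_mul,
      cmpMean_const hν hα0]
    ring
  have h2 := abs_cmpMean_le hν hα0 (pT.sub (pY.const_mul ν)) (p4.const_mul D)
    fun k => hR ((k : ℝ) / α) (by positivity)
  rw [cmpMean_sub hν hα0 pT (pY.const_mul ν), h1, cmpMean_const_mul, cmpMean_const_mul, ← hM] at h2
  have h3 : |-a * δ + b * (2 * δ * M + δ ^ 2) - ν * M| ≤ D * (C * δ ^ 2) :=
    h2.trans (by gcongr; exact h α hαA)
  set x := M + c * δ with hx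
  have h4 : ν * x = 2 * b * δ * x + (b * δ ^ 2 - 2 * b * c * δ ^ 2)
      - (-a * δ + b * (2 * δ * M + δ ^ 2) - ν * M) := by rw [hx, hac]; ring
  -- The error `x` recurs on the right with coefficient `2|b|δ ≤ ν/2`, by `α ≥ 4|b|/ν`, and is
  -- absorbed.
  have h5 : ν * |x| ≤ 2 * (|b| * δ) * |x| + (|b| * δ ^ 2 + |2 * b * c| * δ ^ 2)
      + D * (C * δ ^ 2) := by
    calc ν * |x| = |ν * x| := by rw [abs_mul, abs_of_pos hν]
      _ ≤ |2 * b * δ * x + (b * δ ^ 2 - 2 * b * c * δ ^ 2)| + _ := by rw [h4]; exact abs_sub _ _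
      _ ≤ (|2 * b * δ * x| + (|b * δ ^ 2| + |2 * b * c * δ ^ 2|)) + _ := by
        gcongr
        exact (abs_add_le _ _).trans (by gcongr; exact abs_sub _ _)
      _ = 2 * (|b| * δ) * |x| + (|b| * δ ^ 2 + |2 * b * c| * δ ^ 2) + _ := by
        have e1 : |2 * b * δ * x| = 2 * (|b| * δ) * |x| := by
          rw [abs_mul, abs_mul, abs_mul, abs_two, abs_of_pos hδ0]; ring
        have e2 : |b * δ ^ 2| = |b| * δ ^ 2 := by rw [abs_mul, abs_of_pos (by positivity : 0 < δ ^ 2)]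
        have e3 : |2 * b * c * δ ^ 2| = |2 * b * c| * δ ^ 2 := by
          rw [abs_mul _ (δ ^ 2), abs_of_pos (by positivity : 0 < δ ^ 2)]
        rw [e1, e2, e3]
      _ ≤ _ := by gcongr
  have h6 : 2 * (|b| * δ) * |x| ≤ ν / 2 * |x| := by gcongr; linarith
  have h7 : ν * |x| ≤ 2 * (|b| + D * C + |2 * b * c|) * δ ^ 2 := by linarith
  calc |x| = ν * |x| / ν := by field_simp
    _ ≤ 2 * (|b| + D * C + |2 * b * c|) * δ ^ 2 / ν := by gcongr
    _ = _ := by ring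

end moments

/-! ### The logarithmic derivative of the normalizing constant -/

section normalizingConstant

variable {ν lam : ℝ}

lemma cmpWeight_rpow_one_div (hν : 0 < ν) (hl : 0 < lam) (k : ℕ) :
    cmpWeight ν (lam ^ (1 / ν)) k = lam ^ k / (Nat.factorial k : ℝ) ^ ν := by
  unfold cmpWeight
  rw [Real.div_rpow (by positivity) (by positivity), ← Real.rpow_natCast, ← Real.rpow_mul hl.le,
    ← Real.rpow_mul hl.le, mul_right_comm, one_div_mul_cancel hν.ne', one_mul, Real.rpow_natCast]

lemma cmpZ_eq_tsum_cmpWeight (hν : 0 < ν) (hl : 0 < lam) :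
    cmpZ lam ν = ∑' k, cmpWeight ν (lam ^ (1 / ν)) k :=
  tsum_congr fun k => (cmpWeight_rpow_one_div hν hl k).symm

lemma cmpZ_pos (hν : 0 < ν) (hl : 0 < lam) : 0 < cmpZ lam ν := by
  rw [cmpZ_eq_tsum_cmpWeight hν hl]
  exact tsum_cmpWeight_pos hν (by positivity)

lemma summable_cmpZ (hν : 0 < ν) (hl : 0 < lam) :
    Summable (fun i : ℕ => lam ^ i / (Nat.factorial i : ℝ) ^ ν) :=
  (summable_cmpWeight hν (by positivity : 0 < lam ^ (1 / ν))).congr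
    fun k => cmpWeight_rpow_one_div hν hl k

/-- Termwise differentiation on `(0, lam + 1)`, dominated by the differentiated series at `lam + 1`.
-/
lemma hasDerivAt_cmpZ (hν : 0 < ν) (hl : 0 < lam) :
    HasDerivAt (fun l => cmpZ l ν)
      (cmpZ lam ν / lam * cmpMean ν (lam ^ (1 / ν)) (fun k => (k : ℝ))) lam := by
  have key : HasDerivAt (fun l : ℝ => ∑' i : ℕ, l ^ i / (Nat.factorial i : ℝ) ^ ν)
      (∑' i : ℕ, (i : ℝ) * lam ^ (i - 1) / (Nat.factorial i : ℝ) ^ ν) lam := by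
    have hR : 0 < lam + 1 := by linarith
    have hsum : Summable fun i : ℕ =>
        (i : ℝ) * (lam + 1) ^ (i - 1) / (Nat.factorial i : ℝ) ^ ν := by
      have h := (PolyGrowth.cast.summable hν
        (by positivity : 0 < (lam + 1) ^ (1 / ν))).mul_left (lam + 1)⁻¹
      refine h.congr fun i => ?_
      rw [cmpWeight_rpow_one_div hν hR]
      rcases i with _ | i
      · simp
      · rw [Nat.add_sub_cancel, pow_succ]; field_simp
    refine hasDerivAt_tsum_of_isPreconnected (t := Set.Ioo 0 (lam + 1)) hsum isOpen_Ioo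
      isPreconnected_Ioo (fun i y _ => (hasDerivAt_pow i y).div_const _) (fun i y hy => ?_)
      (y₀ := lam) ⟨hl, by linarith⟩ (summable_cmpZ hν hl) ⟨hl, by linarith⟩
    have hy0 : 0 ≤ y := hy.1.le
    rw [Real.norm_of_nonneg (by positivity)]
    have := hy.2.le
    gcongr
  refine key.congr_deriv ?_
  rw [cmpMean, ← cmpZ_eq_tsum_cmpWeight hν hl]
  have hZ := (cmpZ_pos hν hl).ne'
  rw [div_mul_div_comm, mul_comm (cmpZ lam ν), mul_div_mul_right _ _ hZ, div_eq_inv_mul,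
    ← tsum_mul_left]
  refine tsum_congr fun i => ?_
  rw [cmpWeight_rpow_one_div hν hl]
  rcases i with _ | i
  · simp
  · rw [Nat.add_sub_cancel, pow_succ]; field_simp

/-- The logarithm of `cmpZ lam ν` without its main terms. -/
noncomputable def cmpLogRemainder (ν lam : ℝ) : ℝ :=
  Real.log (cmpZ lam ν) - ν * lam ^ (1 / ν) + (ν - 1) / (2 * ν) * Real.log lam

/-- The main terms are primitives of the two leading terms of `E[K]/lam`, so what remains is exactly
the error in the expansion of the mean. -/
lemma hasDerivAt_cmpLogRemainder (hν : 0 < ν) (hl : 0 < lam) :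
    HasDerivAt (cmpLogRemainder ν)
      (lam ^ (1 / ν) / lam * (cmpMean ν (lam ^ (1 / ν)) (fun k => (k : ℝ) / lam ^ (1 / ν) - 1)
        + (ν - 1) / (2 * ν) * (1 / lam ^ (1 / ν)))) lam := by
  have h1 := (hasDerivAt_cmpZ hν hl).log (cmpZ_pos hν hl).ne'
  have h2 := (Real.hasDerivAt_rpow_const (x := lam) (p := 1 / ν) (Or.inl hl.ne')).const_mul ν
  have h3 := (Real.hasDerivAt_log hl.ne').const_mul ((ν - 1) / (2 * ν))
  refine ((h1.sub h2).add h3).congr_deriv ?_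
  have hα : 0 < lam ^ (1 / ν) := by positivity
  have e : cmpMean ν (lam ^ (1 / ν)) (fun k => (k : ℝ) / lam ^ (1 / ν) - 1) =
      (lam ^ (1 / ν))⁻¹ * cmpMean ν (lam ^ (1 / ν)) (fun k => (k : ℝ)) - 1 := by
    generalize lam ^ (1 / ν) = α at hα
    simp only [div_eq_inv_mul]
    rw [cmpMean_sub hν hα (PolyGrowth.cast.const_mul _) (PolyGrowth.const 1), cmpMean_const_mul,
      cmpMean_const hν hα]
  rw [e, Real.rpow_sub_one hl.ne']
  have hZ := (cmpZ_pos hν hl).ne'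
  field_simp

lemma exists_abs_deriv_cmpLogRemainder_le (hν : 0 < ν) :
    ∃ C L : ℝ, 0 ≤ C ∧ 0 < L ∧ ∀ lam, L ≤ lam →
      |deriv (cmpLogRemainder ν) lam| ≤ C * lam ^ (-(1 / ν) - 1) := by
  obtain ⟨C, A, hC, hA, h⟩ := exists_abs_cmpMean_div_sub_one_add_le hν
  have hA0 : 0 < A := by linarith
  refine ⟨C, A ^ ν, hC, by positivity, fun lam hlam => ?_⟩
  have hl : 0 < lam := lt_of_lt_of_le (by positivity) hlam
  have hα : A ≤ lam ^ (1 / ν) := by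
    have := Real.rpow_le_rpow (by positivity) hlam (by positivity : 0 ≤ 1 / ν)
    rwa [← Real.rpow_mul hA0.le, mul_one_div_cancel hν.ne', Real.rpow_one] at this
  have hα0 : 0 < lam ^ (1 / ν) := by linarith
  rw [(hasDerivAt_cmpLogRemainder hν hl).deriv, abs_mul, abs_of_pos (by positivity)]
  calc _ ≤ lam ^ (1 / ν) / lam * (C * (1 / lam ^ (1 / ν)) ^ 2) := by
        gcongr; exact h _ hα
    _ = _ := by
      rw [Real.rpow_sub_one hl.ne', Real.rpow_neg hl.le]
      field_simp

/-- A limit along a sequence and an integrable derivative give a rate of convergence. -/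
lemma abs_sub_le_of_abs_deriv_le {F : ℝ → ℝ} {a C L c : ℝ} (ha : 0 < a) (hL : 0 < L)
    (hF : ∀ x, L ≤ x → DifferentiableAt ℝ F x)
    (hF' : ∀ x, L ≤ x → |deriv F x| ≤ C * x ^ (-a - 1)) {u : ℕ → ℝ}
    (hu : Tendsto u atTop atTop) (hc : Tendsto (fun n => F (u n)) atTop (nhds c)) {x : ℝ}
    (hx : L ≤ x) : |F x - c| ≤ C / a * x ^ (-a) := by
  have hP : ∀ x, L ≤ x → HasDerivAt (fun x => C / a * x ^ (-a)) (-(C * x ^ (-a - 1))) x := by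
    intro x hx
    have hx0 : 0 < x := hL.trans_le hx
    refine ((Real.hasDerivAt_rpow_const (p := -a) (Or.inl hx0.ne')).const_mul (C / a)).congr_deriv ?_
    field_simp
  have hlim : Tendsto (fun n => C / a * (u n) ^ (-a)) atTop (nhds 0) := by
    simpa using ((tendsto_rpow_neg_atTop ha).comp hu).const_mul (C / a)
  -- With `P = C/a * x^(-a)`, the derivative bound makes `F + P` decreasing and `F - P` increasing;
  -- both tend to `c` along `u`, which traps `c`.
  have anti : AntitoneOn (fun x => F x + C / a * x ^ (-a)) (Set.Ici L) := by
    refine antitoneOn_of_deriv_nonpos (convex_Ici L)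
      (fun y hy => ((hF y hy).add (hP y hy).differentiableAt).continuousAt.continuousWithinAt)
      (fun y hy => ?_) (fun y hy => ?_)
    · rw [interior_Ici] at hy
      exact ((hF y (le_of_lt hy)).add (hP y (le_of_lt hy)).differentiableAt).differentiableWithinAt
    · rw [interior_Ici] at hy
      refine ((hF y (le_of_lt hy)).hasDerivAt.add (hP y (le_of_lt hy))).deriv.trans_le ?_
      linarith [(abs_le.1 (hF' y (le_of_lt hy))).2]
  have mono : MonotoneOn (fun x => F x - C / a * x ^ (-a)) (Set.Ici L) := by
    refine monotoneOn_of_deriv_nonneg (convex_Ici L)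
      (fun y hy => ((hF y hy).sub (hP y hy).differentiableAt).continuousAt.continuousWithinAt)
      (fun y hy => ?_) (fun y hy => ?_)
    · rw [interior_Ici] at hy
      exact ((hF y (le_of_lt hy)).sub (hP y (le_of_lt hy)).differentiableAt).differentiableWithinAt
    · rw [interior_Ici] at hy
      refine le_of_le_of_eq ?_ ((hF y (le_of_lt hy)).hasDerivAt.sub (hP y (le_of_lt hy))).deriv.symm
      linarith [(abs_le.1 (hF' y (le_of_lt hy))).1]
  have h1 : c ≤ F x + C / a * x ^ (-a) := by
    have := hc.add hlim
    rw [add_zero] at this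
    refine le_of_tendsto this ?_
    filter_upwards [hu.eventually_ge_atTop x] with n hn
    exact anti hx (hx.trans hn) hn
  have h2 : F x - C / a * x ^ (-a) ≤ c := by
    have := hc.sub hlim
    rw [sub_zero] at this
    refine ge_of_tendsto this ?_
    filter_upwards [hu.eventually_ge_atTop x] with n hn
    exact mono hx (hx.trans hn) hn
  rw [abs_le]
  constructor <;> linarith

lemma cmpZ_eq_cmpLeading_mul_exp (hν : 0 < ν) (hl : 0 < lam) :
    cmpZ lam ν = cmpLeading lam ν * Real.exp (cmpLogRemainder ν lam -
      (-Real.log ((2 * Real.pi) ^ ((ν - 1) / 2) * Real.sqrt ν))) := by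
  have hπ := Real.pi_pos
  have hZ := cmpZ_pos hν hl
  have hc : 0 < (2 * Real.pi) ^ ((ν - 1) / 2) * Real.sqrt ν := by positivity
  have hp : 0 < lam ^ ((ν - 1) / (2 * ν)) := by positivity
  have e : cmpLogRemainder ν lam - (-Real.log ((2 * Real.pi) ^ ((ν - 1) / 2) * Real.sqrt ν)) =
      Real.log (cmpZ lam ν) + Real.log (lam ^ ((ν - 1) / (2 * ν))) +
        Real.log ((2 * Real.pi) ^ ((ν - 1) / 2) * Real.sqrt ν) - ν * lam ^ (1 / ν) := by
    rw [cmpLogRemainder, Real.log_rpow hl]; ring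
  rw [e, Real.exp_sub, Real.exp_add, Real.exp_add, Real.exp_log hZ, Real.exp_log hp,
    Real.exp_log hc, cmpLeading]
  field_simp

/-- The derivative bound provides the rate, so the limit is needed along one sequence only; `lam = n
^ ν` makes `α` the integer `n`. -/
lemma exists_isBigO_cmpZ_of_tendsto (hν : 0 < ν)
    (hlim : Tendsto (fun n : ℕ => cmpLogRemainder ν ((n : ℝ) ^ ν)) atTop
      (nhds (-Real.log ((2 * Real.pi) ^ ((ν - 1) / 2) * Real.sqrt ν)))) :
    ∃ ε : ℝ → ℝ, ε =O[atTop] (fun lam : ℝ => lam ^ (-(1 / ν))) ∧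
      ∀ lam : ℝ, 0 < lam → cmpZ lam ν = cmpLeading lam ν * (1 + ε lam) := by
  set c := -Real.log ((2 * Real.pi) ^ ((ν - 1) / 2) * Real.sqrt ν) with hc
  obtain ⟨C, L, hC, hL, h⟩ := exists_abs_deriv_cmpLogRemainder_le hν
  refine ⟨fun lam => Real.exp (cmpLogRemainder ν lam - c) - 1, ?_, fun lam hl => ?_⟩
  · have hν' : 0 < 1 / ν := by positivity
    have hbd : ∀ x, L ≤ x → |cmpLogRemainder ν x - c| ≤ C / (1 / ν) * x ^ (-(1 / ν)) :=
      fun x hx => abs_sub_le_of_abs_deriv_le hν' hL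
        (fun x hx => (hasDerivAt_cmpLogRemainder hν (hL.trans_le hx)).differentiableAt) h
        ((tendsto_rpow_atTop hν).comp tendsto_natCast_atTop_atTop) hlim hx
    have hO : (fun x => cmpLogRemainder ν x - c) =O[atTop] (fun x : ℝ => x ^ (-(1 / ν))) := by
      refine IsBigO.of_bound (C / (1 / ν)) ?_
      filter_upwards [eventually_ge_atTop L] with x hx
      have hx0 : 0 < x := hL.trans_le hx
      rw [Real.norm_eq_abs, Real.norm_of_nonneg (by positivity)]
      exact hbd x hx
    have h0 : Tendsto (fun x => cmpLogRemainder ν x - c) atTop (nhds 0) :=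
      hO.trans_tendsto (tendsto_rpow_neg_atTop hν')
    have hexp : (fun y : ℝ => Real.exp y - 1) =O[nhds 0] fun y => y := by
      have := (Real.hasDerivAt_exp 0).isBigO_sub
      simpa using this
    exact (hexp.comp_tendsto h0).trans hO
  · rw [add_sub_cancel]
    exact cmpZ_eq_cmpLeading_mul_exp hν hl

/-- The normalizing constant as a Poisson expectation. -/
lemma integrable_and_cmpZ_eq_exp_mul_integral {α : ℝ} (hν : 0 < ν) (hl : 0 < lam)
    (hα : α = lam ^ (1 / ν)) :
    Integrable (fun k : ℕ => (α ^ k / (Nat.factorial k : ℝ)) ^ (ν - 1)) (poissonLaw α) ∧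
      cmpZ lam ν =
        Real.exp α * ∫ k : ℕ, (α ^ k / (Nat.factorial k : ℝ)) ^ (ν - 1) ∂(poissonLaw α) := by
  have hα0 : 0 < α := by rw [hα]; positivity
  have hcoe : ((α.toNNReal : NNReal) : ℝ) = α := Real.coe_toNNReal _ hα0.le
  have hterm : ∀ k : ℕ, Real.exp (-α) * α ^ k / (Nat.factorial k : ℝ) *
      (α ^ k / (Nat.factorial k : ℝ)) ^ (ν - 1) = Real.exp (-α) * cmpWeight ν α k := by
    intro k
    rw [cmpWeight, Real.rpow_sub_one (by positivity)]
    field_simp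
  constructor
  · rw [poissonLaw, integrable_poissonMeasure_iff]
    refine ((summable_cmpWeight hν hα0).mul_left (Real.exp (-α))).congr fun k => ?_
    rw [hcoe, Real.norm_of_nonneg (by positivity), hterm]
  · rw [poissonLaw, integral_poissonMeasure, cmpZ_eq_tsum_cmpWeight hν hl, ← hα]
    simp only [hcoe, smul_eq_mul, hterm]
    rw [tsum_mul_left, ← mul_assoc, ← Real.exp_add, add_neg_cancel, Real.exp_zero, one_mul]

end normalizingConstant

/-! ### The limit of the normalizing constant along integer means -/

/-- The ratio of the Poisson weight of mean `n` at `n + j` to its weight at `n`. -/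
noncomputable def poissonRatio (n : ℕ) (j : ℤ) : ℝ :=
  if 0 ≤ (n : ℤ) + j then
    (n : ℝ) ^ ((n : ℤ) + j).toNat / (Nat.factorial ((n : ℤ) + j).toNat : ℝ) *
      ((Nat.factorial n : ℝ) / (n : ℝ) ^ n)
  else 0

lemma poissonRatio_nonneg (n : ℕ) (j : ℤ) : 0 ≤ poissonRatio n j := by
  unfold poissonRatio; split_ifs <;> positivity

lemma poissonRatio_cast_sub (n k : ℕ) :
    poissonRatio n ((k : ℤ) - n) =
      (n : ℝ) ^ k / (Nat.factorial k : ℝ) * ((Nat.factorial n : ℝ) / (n : ℝ) ^ n) := by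
  simp [poissonRatio]

/-- Consecutive ratios are `1 - (i+1)/(n+i+1) ≤ exp(-(i+1)/N)`, and the exponents add up. The common
bound `N` keeps the denominator fixed during the induction. -/
lemma poissonRatio_nat_le {n : ℕ} (hn : 0 < n) (i N : ℕ) (h : n + i ≤ N) :
    poissonRatio n (i : ℤ) ≤ Real.exp (-((i : ℝ) * (i + 1) / (2 * N))) := by
  have hN : (0 : ℝ) < N := by exact_mod_cast (show 0 < N by omega)
  have hn' : (0 : ℝ) < n := by exact_mod_cast hn
  induction i with
  | zero =>
    have := poissonRatio_cast_sub n n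
    rw [sub_self] at this
    simp only [Nat.cast_zero, zero_mul, zero_div, neg_zero, Real.exp_zero]
    rw [this]
    field_simp
    rfl
  | succ i ih =>
    have e : poissonRatio n ((i + 1 : ℕ) : ℤ) =
        poissonRatio n (i : ℤ) * ((n : ℝ) / ((n : ℝ) + i + 1)) := by
      have h1 := poissonRatio_cast_sub n (n + i)
      have h2 := poissonRatio_cast_sub n (n + i + 1)
      rw [show (((n + i : ℕ) : ℤ) - n) = i by push_cast; ring] at h1
      rw [show (((n + i + 1 : ℕ) : ℤ) - n) = ((i + 1 : ℕ) : ℤ) by push_cast; ring] at h2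
      rw [h1, h2, Nat.factorial_succ, pow_succ]
      push_cast
      field_simp
    have h3 : (n : ℝ) / ((n : ℝ) + i + 1) ≤ Real.exp (-(((i : ℝ) + 1) / N)) := by
      have hle : (n : ℝ) + i + 1 ≤ N := by exact_mod_cast h
      calc (n : ℝ) / ((n : ℝ) + i + 1) = 1 - ((i : ℝ) + 1) / ((n : ℝ) + i + 1) := by
            field_simp; ring
        _ ≤ 1 - ((i : ℝ) + 1) / N := by gcongr
        _ ≤ _ := Real.one_sub_le_exp_neg _
    rw [e]
    calc _ ≤ Real.exp (-((i : ℝ) * (i + 1) / (2 * N))) * Real.exp (-(((i : ℝ) + 1) / N)) := by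
          gcongr
          exact ih (by omega)
      _ = _ := by
        rw [← Real.exp_add]; congr 1; push_cast; field_simp; ring

lemma poissonRatio_neg_le {n : ℕ} (hn : 0 < n) (i : ℕ) :
    poissonRatio n (-(i : ℤ)) ≤ Real.exp (-((i : ℝ) * (i - 1) / (2 * n))) := by
  have hn' : (0 : ℝ) < n := by exact_mod_cast hn
  rcases lt_or_ge n i with hi | hi
  · rw [poissonRatio, if_neg (by omega)]; positivity
  induction i with
  | zero =>
    have := poissonRatio_cast_sub n n
    rw [sub_self] at this
    simp only [Nat.cast_zero, zero_mul, zero_div, neg_zero, Real.exp_zero]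
    rw [this]
    field_simp
    rfl
  | succ i ih =>
    obtain ⟨k, rfl⟩ := Nat.exists_eq_add_of_le hi
    set n := i + 1 + k with hn_def
    have e : poissonRatio n (-((i + 1 : ℕ) : ℤ)) =
        poissonRatio n (-(i : ℤ)) * (((k : ℝ) + 1) / n) := by
      have h1 := poissonRatio_cast_sub n k
      have h2 := poissonRatio_cast_sub n (k + 1)
      rw [show ((k : ℤ) - n) = -((i + 1 : ℕ) : ℤ) by rw [hn_def]; push_cast; ring] at h1
      rw [show (((k + 1 : ℕ) : ℤ) - n) = -(i : ℤ) by rw [hn_def]; push_cast; ring] at h2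
      rw [h1, h2, Nat.factorial_succ, pow_succ]
      push_cast
      field_simp
    have h3 : ((k : ℝ) + 1) / n ≤ Real.exp (-((i : ℝ) / n)) := by
      calc ((k : ℝ) + 1) / n = 1 - (i : ℝ) / n := by
            rw [eq_sub_iff_add_eq, ← add_div, div_eq_one_iff_eq hn'.ne', hn_def]; push_cast; ring
        _ ≤ _ := Real.one_sub_le_exp_neg _
    rw [e]
    calc _ ≤ Real.exp (-((i : ℝ) * (i - 1) / (2 * n))) * Real.exp (-((i : ℝ) / n)) := by
          gcongr
          exact ih (by omega)
      _ = _ := by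
        rw [← Real.exp_add]; congr 1; push_cast; field_simp; ring

/-- The dominating function for the limit of integrals. The right-tail exponent `i(i+1)/(2(n+i))`
grows only linearly once `i` exceeds `n`, hence an exponential bound, uniform in `n`, instead of a
Gaussian one. -/
lemma poissonRatio_floor_le {n : ℕ} (hn : 0 < n) (x : ℝ) :
    poissonRatio n ⌊x * Real.sqrt n⌋ ≤ Real.exp (1 - |x| / 2) := by
  have hn' : (1 : ℝ) ≤ n := by exact_mod_cast hn
  set s := Real.sqrt n with hs
  have hss : s * s = n := Real.mul_self_sqrt (by linarith)
  have hs1 : 1 ≤ s := by rw [hs, Real.one_le_sqrt]; exact hn'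
  have hle := Int.floor_le (x * s)
  have hlt := Int.lt_floor_add_one (x * s)
  obtain ⟨i, hi | hi⟩ := Int.eq_nat_or_neg ⌊x * s⌋
  · rw [hi] at hle hlt ⊢
    push_cast at hle hlt
    refine (poissonRatio_nat_le hn i (n + i) le_rfl).trans (Real.exp_le_exp.2 ?_)
    have hx0 : 0 ≤ x := by
      by_contra h
      push Not at h
      have : x * s < 0 := mul_neg_of_neg_of_pos h (by linarith)
      linarith [Nat.cast_nonneg (α := ℝ) i]
    rw [abs_of_nonneg hx0]
    push_cast
    have hpos : (0 : ℝ) < 2 * (n + i) := by positivity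
    have : x / 2 - 1 ≤ (i : ℝ) * (i + 1) / (2 * (n + i)) := by
      rw [le_div_iff₀ hpos]
      have hi0 : (0 : ℝ) ≤ i := Nat.cast_nonneg i
      rw [← hss]
      -- For `x ≤ 2` the left side is nonpositive. Otherwise `s ≥ 1` turns `x s < i + 1` into `(x -
      -- 1) s ≤ i`.
      rcases le_total x 2 with h2 | h2
      · nlinarith [mul_nonneg (sub_nonneg.2 h2) hpos.le]
      · have hy : (x - 1) * s ≤ i := by nlinarith
        have h4 : (x - 2) * (s * s + i) ≤ i * i := by
          have e1 : (x - 2) * s ≤ i - s := by nlinarith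
          have e2 : (x - 2) * (s * s) ≤ (i - s) * s := by nlinarith
          have e3 : (x - 2) * s * i ≤ (i - s) * i := by nlinarith
          have e4 : s ≤ i := by nlinarith
          have e5 : (x - 2) * i ≤ (i - s) * i / s := by
            rw [le_div_iff₀ (by linarith)]; nlinarith
          have e6 : (i - s) * i / s ≤ (i - s) * i :=
            div_le_self (mul_nonneg (by linarith) hi0) hs1
          nlinarith
        nlinarith
    linarith
  · rw [hi] at hle hlt ⊢
    push_cast at hle hlt
    refine (poissonRatio_neg_le hn i).trans (Real.exp_le_exp.2 ?_)
    have hi0 : (0 : ℝ) ≤ i := Nat.cast_nonneg i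
    have hpos : (0 : ℝ) < 2 * n := by positivity
    have : |x| / 2 - 1 ≤ (i : ℝ) * (i - 1) / (2 * n) := by
      rw [le_div_iff₀ hpos]
      rcases Nat.eq_zero_or_pos i with rfl | hi1
      · have : |x| ≤ 1 := by
          simp at hle hlt
          rw [abs_le]; constructor <;> nlinarith
        simp
        nlinarith
      · have hi1' : (1 : ℝ) ≤ i := by exact_mod_cast hi1
        have hx0 : x ≤ 0 := by
          by_contra h
          push Not at h
          have : 0 < x * s := by positivity
          linarith
        rw [abs_of_nonpos hx0]
        have h1 : (-x) * s ≤ i := by linarith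
        rcases le_total (-x) 2 with h2 | h2
        · nlinarith [mul_nonneg hi0 (sub_nonneg.2 hi1'), mul_nonneg (sub_nonneg.2 h2) hpos.le]
        · rw [← hss]
          have h3 : (-x - 2) * (s * s) ≤ (i - 2 * s) * s := by nlinarith
          nlinarith [sq_nonneg (i - s)]
    linarith

/-- Stirling's formula at `n(1+t)` leaves the exponent `-n((1+t) log(1+t) - t)`; its leading part
`-n t²/2` produces the Gaussian. -/
lemma abs_mul_log_sub_le {t : ℝ} (ht : |t| ≤ 1 / 2) :
    |(1 + t) * Real.log (1 + t) - t - t ^ 2 / 2| ≤ 4 * |t| ^ 3 := by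
  have h := Real.abs_log_sub_add_sum_range_le (x := -t) (by rw [abs_neg]; linarith) 2
  simp only [Finset.sum_range_succ, Finset.sum_range_zero, abs_neg, sub_neg_eq_add] at h
  norm_num at h
  set ρ := -t + t ^ 2 / 2 + Real.log (1 + t) with hρ
  have h0 := abs_nonneg t
  have h1 : |ρ| ≤ 2 * |t| ^ 3 := by
    refine h.trans ?_
    rw [div_le_iff₀ (by linarith)]
    nlinarith [pow_nonneg h0 3]
  have e : (1 + t) * Real.log (1 + t) - t - t ^ 2 / 2 = -(t ^ 3 / 2) + (1 + t) * ρ := by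
    rw [hρ]; ring
  have h2 : |1 + t| ≤ 3 / 2 := by
    rw [abs_le] at ht ⊢; constructor <;> linarith [ht.1, ht.2]
  rw [e]
  calc _ ≤ |-(t ^ 3 / 2)| + |(1 + t) * ρ| := abs_add_le _ _
    _ = |t| ^ 3 / 2 + |1 + t| * |ρ| := by
      rw [abs_neg, abs_div, abs_pow, abs_two, abs_mul]
    _ ≤ |t| ^ 3 / 2 + 3 / 2 * (2 * |t| ^ 3) := by gcongr
    _ ≤ _ := by nlinarith [pow_nonneg h0 3]

lemma log_factorial_eq {n : ℕ} (hn : 0 < n) :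
    Real.log (Nat.factorial n : ℝ) = Real.log (Stirling.stirlingSeq n) +
      1 / 2 * (Real.log 2 + Real.log n) + n * Real.log n - n := by
  have hn' : (n : ℝ) ≠ 0 := by exact_mod_cast hn.ne'
  have h := Stirling.log_stirlingSeq_formula n
  rw [Real.log_div hn' (Real.exp_pos 1).ne', Real.log_exp, Real.log_mul two_ne_zero hn'] at h
  linarith

lemma tendsto_floor_mul_sqrt_div_sqrt (x : ℝ) :
    Tendsto (fun n : ℕ => (⌊x * Real.sqrt n⌋ : ℝ) / Real.sqrt n) atTop (nhds x) := by
  have hs : Tendsto (fun n : ℕ => Real.sqrt n) atTop atTop :=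
    Real.tendsto_sqrt_atTop.comp tendsto_natCast_atTop_atTop
  have h := (tendsto_const_nhds (x := x)).sub (tendsto_inv_atTop_zero.comp hs)
  rw [sub_zero] at h
  refine tendsto_of_tendsto_of_tendsto_of_le_of_le' h tendsto_const_nhds ?_ ?_
  · filter_upwards [hs.eventually_gt_atTop 0] with n hn
    simp only [Function.comp]
    rw [le_div_iff₀ hn, sub_mul, inv_mul_cancel₀ hn.ne']
    linarith [Int.lt_floor_add_one (x * Real.sqrt n)]
  · filter_upwards [hs.eventually_gt_atTop 0] with n hn
    rw [div_le_iff₀ hn]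
    exact Int.floor_le _

/-- A local limit theorem at the mean: with `t = ⌊x√n⌋/n` one has `n t² → x²`, while the cubic error
`n|t|³` vanishes and the Stirling constants at `n` and `n(1+t)` cancel in the limit. -/
lemma tendsto_poissonRatio_floor (x : ℝ) :
    Tendsto (fun n : ℕ => poissonRatio n ⌊x * Real.sqrt n⌋) atTop
      (nhds (Real.exp (-(x ^ 2 / 2)))) := by
  set j : ℕ → ℤ := fun n => ⌊x * Real.sqrt n⌋ with hj
  set t : ℕ → ℝ := fun n => (j n : ℝ) / n with ht
  set k : ℕ → ℕ := fun n => ((n : ℤ) + j n).toNat with hk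
  have hs : Tendsto (fun n : ℕ => Real.sqrt n) atTop atTop :=
    Real.tendsto_sqrt_atTop.comp tendsto_natCast_atTop_atTop
  have hy := tendsto_floor_mul_sqrt_div_sqrt x
  have ht_eq : ∀ n : ℕ, t n = (j n : ℝ) / Real.sqrt n * (Real.sqrt n)⁻¹ := fun n => by
    rw [← div_eq_mul_inv, div_div, Real.mul_self_sqrt (Nat.cast_nonneg n)]
  have ht0 : Tendsto t atTop (nhds 0) := by
    have := hy.mul (tendsto_inv_atTop_zero.comp hs)
    rw [mul_zero] at this
    exact this.congr fun n => (ht_eq n).symm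
  have hnt2 : Tendsto (fun n : ℕ => (n : ℝ) * t n ^ 2) atTop (nhds (x ^ 2)) := by
    refine (hy.pow 2).congr' ?_
    filter_upwards [eventually_gt_atTop 0] with n hn
    have hn' : (0 : ℝ) < n := by exact_mod_cast hn
    rw [div_pow, Real.sq_sqrt hn'.le, ht]
    field_simp
    rfl
  have hev : ∀ᶠ n : ℕ in atTop, 0 < n ∧ |t n| ≤ 1 / 2 := by
    refine (eventually_gt_atTop 0).and ?_
    have := ht0.abs
    rw [abs_zero] at this
    exact this.eventually_le_const (by norm_num)
  have hmain : ∀ᶠ n : ℕ in atTop, 0 < k n ∧ (k n : ℝ) = n * (1 + t n) ∧ 0 < 1 + t n ∧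
      0 ≤ (n : ℤ) + j n := by
    filter_upwards [hev] with n ⟨hn, htn⟩
    have hn' : (0 : ℝ) < n := by exact_mod_cast hn
    have h1 : 0 < 1 + t n := by linarith [(abs_le.1 htn).1]
    have h2 : ((n : ℤ) + j n : ℤ) = (n : ℝ) * (1 + t n) := by
      rw [ht]; push_cast; field_simp
    have h3 : 0 < (n : ℤ) + j n := by
      have : (0 : ℝ) < ((n : ℤ) + j n : ℤ) := by rw [h2]; positivity
      exact_mod_cast this
    have h4 : ((k n : ℕ) : ℤ) = (n : ℤ) + j n := Int.toNat_of_nonneg h3.le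
    refine ⟨by omega, ?_, h1, h3.le⟩
    rw [← h2, ← h4]; simp
  have hk_top : Tendsto k atTop atTop := by
    have : Tendsto (fun n : ℕ => (k n : ℝ)) atTop atTop := by
      have h1 : Tendsto (fun n : ℕ => (n : ℝ) * (1 + t n)) atTop atTop := by
        refine tendsto_natCast_atTop_atTop.atTop_mul_pos (C := 1) one_pos ?_
        simpa using ht0.const_add 1
      refine h1.congr' ?_
      filter_upwards [hmain] with n hn using hn.2.1.symm
    exact tendsto_natCast_atTop_iff.1 this
  have hst : Tendsto (fun n => Real.log (Stirling.stirlingSeq n)) atTop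
      (nhds (Real.log (Real.sqrt Real.pi))) :=
    Stirling.tendsto_stirlingSeq_sqrt_pi.log (Real.sqrt_pos.2 Real.pi_pos).ne'
  have hlog : Tendsto (fun n => Real.log (1 + t n)) atTop (nhds 0) := by
    have := (ht0.const_add 1).log (by simp)
    simpa using this
  have hρ : Tendsto (fun n : ℕ => (n : ℝ) *
      ((1 + t n) * Real.log (1 + t n) - t n - t n ^ 2 / 2)) atTop (nhds 0) := by
    have h0 : Tendsto (fun n : ℕ => 4 * ((n : ℝ) * t n ^ 2 * |t n|)) atTop (nhds 0) := by
      simpa using (hnt2.mul ht0.abs).const_mul 4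
    refine squeeze_zero_norm' ?_ h0
    filter_upwards [hev] with n ⟨hn, htn⟩
    rw [Real.norm_eq_abs, abs_mul, Nat.abs_cast]
    calc _ ≤ (n : ℝ) * (4 * |t n| ^ 3) := by gcongr; exact abs_mul_log_sub_le htn
      _ = _ := by rw [← sq_abs (t n)]; ring
  have hexp : Tendsto (fun n : ℕ => Real.exp (Real.log (Stirling.stirlingSeq n) -
      Real.log (Stirling.stirlingSeq (k n)) - 1 / 2 * Real.log (1 + t n) -
      ((n : ℝ) * ((1 + t n) * Real.log (1 + t n) - t n - t n ^ 2 / 2) +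
        (n : ℝ) * t n ^ 2 / 2))) atTop (nhds (Real.exp (-(x ^ 2 / 2)))) := by
    refine (Real.continuous_exp.tendsto _).comp ?_
    have := ((hst.sub (hst.comp hk_top)).sub (hlog.const_mul (1 / 2))).sub
      (hρ.add (hnt2.div_const 2))
    simpa using this
  refine hexp.congr' ?_
  filter_upwards [hev, hmain] with n ⟨hn, htn⟩ ⟨hk0, hkn, h1, hpos⟩
  have hn' : (0 : ℝ) < n := by exact_mod_cast hn
  have hk' : (0 : ℝ) < k n := by exact_mod_cast hk0
  have hfk : (0 : ℝ) < (Nat.factorial (k n) : ℝ) := by positivity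
  have hfn : (0 : ℝ) < (Nat.factorial n : ℝ) := by positivity
  have hr : poissonRatio n (j n) = Real.exp ((k n * Real.log n - Real.log (Nat.factorial (k n) : ℝ))
      + (Real.log (Nat.factorial n : ℝ) - n * Real.log n)) := by
    rw [poissonRatio, if_pos hpos, Real.exp_add, Real.exp_sub, Real.exp_sub, Real.exp_log hfk,
      Real.exp_log hfn, ← Real.log_pow, ← Real.log_pow, Real.exp_log (by positivity),
      Real.exp_log (by positivity)]
  rw [hr, log_factorial_eq hn, log_factorial_eq hk0, hkn, Real.log_mul hn'.ne' h1.ne']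
  congr 1
  ring

lemma integral_comp_floor {g : ℤ → ℝ} (hg : Integrable (fun y : ℝ => g ⌊y⌋)) :
    ∫ y : ℝ, g ⌊y⌋ = ∑' j : ℤ, g j := by
  have h := hasSum_integral_iUnion (μ := volume) (s := fun j : ℤ => Set.Ico (j : ℝ) (j + 1))
    (f := fun y : ℝ => g ⌊y⌋) (fun j => measurableSet_Ico)
    (Set.pairwise_disjoint_Ico_intCast ℝ) hg.integrableOn
  rw [iUnion_Ico_intCast, setIntegral_univ] at h
  rw [← h.tsum_eq]
  refine tsum_congr fun j => ?_
  rw [setIntegral_congr_fun (g := fun _ => g j) measurableSet_Ico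
    fun y hy => by simp only [Int.floor_eq_iff.2 hy]]
  simp

lemma integrable_exp_sub_mul_abs {b : ℝ} (hb : 0 < b) (a : ℝ) :
    Integrable (fun x : ℝ => Real.exp (a - b * |x|)) := by
  have hc : 0 < min 1 (b ^ 2 / 2) := by positivity
  refine (integrable_inv_one_add_sq.const_mul (Real.exp a * (min 1 (b ^ 2 / 2))⁻¹)).mono'
    (by fun_prop) (Eventually.of_forall fun x => ?_)
  rw [Real.norm_of_nonneg (Real.exp_pos _).le, sub_eq_add_neg, Real.exp_add, Real.exp_neg,
    mul_assoc, ← mul_inv]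
  have h := Real.quadratic_le_exp_of_nonneg (x := b * |x|) (by positivity)
  have h1 : min 1 (b ^ 2 / 2) ≤ 1 := min_le_left _ _
  have h2 : min 1 (b ^ 2 / 2) ≤ b ^ 2 / 2 := min_le_right _ _
  have h3 : min 1 (b ^ 2 / 2) * (1 + x ^ 2) ≤ Real.exp (b * |x|) := by
    rw [mul_pow, sq_abs] at h
    have : 0 ≤ b * |x| := by positivity
    nlinarith [sq_nonneg x]
  gcongr

lemma tendsto_integral_poissonRatio_rpow {ν : ℝ} (hν : 0 < ν) :
    Tendsto (fun n : ℕ => ∫ x : ℝ, poissonRatio n ⌊x * Real.sqrt n⌋ ^ ν) atTop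
      (nhds (Real.sqrt (2 * Real.pi / ν))) := by
  have hint : ∫ x : ℝ, Real.exp (-(x ^ 2 / 2)) ^ ν = Real.sqrt (2 * Real.pi / ν) := by
    rw [show 2 * Real.pi / ν = Real.pi / (ν / 2) by field_simp, ← integral_gaussian]
    congr 1; ext x
    rw [← Real.exp_mul]; congr 1; ring
  rw [← hint]
  refine tendsto_integral_filter_of_dominated_convergence
    (fun x => Real.exp (ν - ν / 2 * |x|)) ?_ ?_ (integrable_exp_sub_mul_abs (by positivity) _) ?_
  · refine Eventually.of_forall fun n => Measurable.aestronglyMeasurable ?_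
    have : Measurable (poissonRatio n) := measurable_from_top
    exact (this.comp (Int.measurable_floor.comp (measurable_id.mul_const _))).pow_const ν
  · filter_upwards [eventually_gt_atTop 0] with n hn
    refine Eventually.of_forall fun x => ?_
    have h0 := poissonRatio_nonneg n ⌊x * Real.sqrt n⌋
    rw [Real.norm_of_nonneg (Real.rpow_nonneg h0 _)]
    calc _ ≤ Real.exp (1 - |x| / 2) ^ ν :=
          Real.rpow_le_rpow h0 (poissonRatio_floor_le hn x) hν.le
      _ = _ := by rw [← Real.exp_mul]; congr 1; ring
  · exact Eventually.of_forall fun x =>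
      (tendsto_poissonRatio_floor x).rpow_const (Or.inr hν.le)

/-- After `y = x√n` the integrand is constant on unit intervals, so the integral is a sum over
integers: `Z` at `lam = n ^ ν` divided by its weight at `n`. -/
lemma integral_poissonRatio_rpow {ν : ℝ} (hν : 0 < ν) {n : ℕ} (hn : 0 < n) :
    ∫ x : ℝ, poissonRatio n ⌊x * Real.sqrt n⌋ ^ ν =
      (Real.sqrt n)⁻¹ * (cmpZ ((n : ℝ) ^ ν) ν * ((Nat.factorial n : ℝ) / (n : ℝ) ^ n) ^ ν) := by
  have hn' : (0 : ℝ) < n := by exact_mod_cast hn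
  have hs : 0 < Real.sqrt n := Real.sqrt_pos.2 hn'
  have hint : Integrable fun y : ℝ => poissonRatio n ⌊y⌋ ^ ν := by
    refine (integrable_exp_sub_mul_abs (b := ν / 2 / Real.sqrt n) (by positivity) ν).mono' ?_
      (Eventually.of_forall fun y => ?_)
    · have : Measurable (poissonRatio n) := measurable_from_top
      exact ((this.comp Int.measurable_floor).pow_const ν).aestronglyMeasurable
    · have h0 := poissonRatio_nonneg n ⌊y⌋
      have h := poissonRatio_floor_le hn (y / Real.sqrt n)
      rw [div_mul_cancel₀ _ hs.ne', abs_div, abs_of_pos hs] at h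
      rw [Real.norm_of_nonneg (Real.rpow_nonneg h0 _)]
      calc _ ≤ Real.exp (1 - |y| / Real.sqrt n / 2) ^ ν := Real.rpow_le_rpow h0 h hν.le
        _ = _ := by rw [← Real.exp_mul]; congr 1; field_simp
  rw [Measure.integral_comp_mul_right (fun y : ℝ => poissonRatio n ⌊y⌋ ^ ν), smul_eq_mul,
    abs_of_pos (inv_pos.2 hs), integral_comp_floor (g := fun j => poissonRatio n j ^ ν) hint]
  congr 1
  have hinj : Function.Injective fun k : ℕ => (k : ℤ) - n := fun a b h => by simpa using h
  rw [← hinj.tsum_eq]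
  · rw [cmpZ_eq_tsum_cmpWeight hν (by positivity), ← tsum_mul_right]
    refine tsum_congr fun k => ?_
    rw [poissonRatio_cast_sub, Real.mul_rpow (by positivity) (by positivity), cmpWeight,
      ← Real.rpow_mul hn'.le, mul_one_div_cancel hν.ne', Real.rpow_one]
  -- Integers below `-n` contribute nothing: the ratio is `0` there by definition, and `0 ^ ν = 0`.
  · intro j hj
    by_cases h : 0 ≤ (n : ℤ) + j
    · exact ⟨((n : ℤ) + j).toNat, by simp only [Int.toNat_of_nonneg h]; ring⟩
    · simp [poissonRatio, h, Real.zero_rpow hν.ne'] at hj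

lemma tendsto_cmpLogRemainder_natCast_rpow {ν : ℝ} (hν : 0 < ν) :
    Tendsto (fun n : ℕ => cmpLogRemainder ν ((n : ℝ) ^ ν)) atTop
      (nhds (-Real.log ((2 * Real.pi) ^ ((ν - 1) / 2) * Real.sqrt ν))) := by
  have hπ := Real.pi_pos
  have h1 := (tendsto_integral_poissonRatio_rpow hν).log
    (Real.sqrt_pos.2 (by positivity : 0 < 2 * Real.pi / ν)).ne'
  have h2 := (Stirling.tendsto_stirlingSeq_sqrt_pi.log
    (Real.sqrt_pos.2 Real.pi_pos).ne').const_mul ν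
  have h3 := (h1.sub h2).sub_const (ν / 2 * Real.log 2)
  have e : Real.log (Real.sqrt (2 * Real.pi / ν)) - ν * Real.log (Real.sqrt Real.pi) -
      ν / 2 * Real.log 2 = -Real.log ((2 * Real.pi) ^ ((ν - 1) / 2) * Real.sqrt ν) := by
    rw [Real.log_sqrt (by positivity), Real.log_sqrt hπ.le,
      Real.log_mul (by positivity) (by positivity), Real.log_rpow (by positivity),
      Real.log_sqrt hν.le, Real.log_div (by positivity) hν.ne', Real.log_mul two_ne_zero hπ.ne']
    ring
  rw [e] at h3
  refine h3.congr' ?_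
  filter_upwards [eventually_gt_atTop 0] with n hn
  have hn' : (0 : ℝ) < n := by exact_mod_cast hn
  have hZ := cmpZ_pos hν (by positivity : 0 < (n : ℝ) ^ ν)
  have hfn : (0 : ℝ) < (Nat.factorial n : ℝ) := by positivity
  rw [integral_poissonRatio_rpow hν hn, Real.log_mul (by positivity) (by positivity),
    Real.log_mul hZ.ne' (by positivity), Real.log_rpow (by positivity),
    Real.log_div (by positivity) (by positivity), Real.log_inv, Real.log_sqrt hn'.le, Real.log_pow,
    log_factorial_eq hn, cmpLogRemainder, ← Real.rpow_mul hn'.le, mul_one_div_cancel hν.ne',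
    Real.rpow_one, Real.log_rpow hn']
  field_simp
  ring

/-! ### The Stein equation of the standard normal law -/

/-- `g` is negligible against the inverse of the Gaussian density at infinity. -/
def GaussDecay (g : ℝ → ℝ) : Prop :=
  Tendsto (fun x => Real.exp (-(x ^ 2 / 2)) * g x) (cocompact ℝ) (nhds 0)

namespace GaussDecay

variable {f g : ℝ → ℝ}

lemma neg (hg : GaussDecay g) : GaussDecay (fun x => -g x) := by
  have := Tendsto.neg hg
  simpa [GaussDecay] using this

lemma sub (hf : GaussDecay f) (hg : GaussDecay g) : GaussDecay (fun x => f x - g x) := by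
  have := Tendsto.sub hf hg
  simpa [GaussDecay, mul_sub] using this

lemma comp_neg (hg : GaussDecay g) : GaussDecay (fun x => g (-x)) := by
  have h : Tendsto (fun x : ℝ => -x) (cocompact ℝ) (cocompact ℝ) :=
    (Homeomorph.neg ℝ).isClosedEmbedding.tendsto_cocompact
  have := Tendsto.comp hg h
  simpa [GaussDecay, Function.comp_def] using this

lemma of_le {D : ℝ} (h : ∀ x, |g x| ≤ D * (1 + |x|)) : GaussDecay g := by
  have h0 := tendsto_rpow_abs_mul_exp_neg_mul_sq_cocompact (a := 1 / 2) (by norm_num) 0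
  have h1 := tendsto_rpow_abs_mul_exp_neg_mul_sq_cocompact (a := 1 / 2) (by norm_num) 1
  have h2 := (h0.add h1).const_mul D
  rw [add_zero, mul_zero] at h2
  refine squeeze_zero_norm (fun x => ?_) h2
  rw [norm_mul, Real.norm_of_nonneg (Real.exp_pos _).le, Real.norm_eq_abs, Real.rpow_zero,
    Real.rpow_one, one_mul, show -(1 / 2) * x ^ 2 = -(x ^ 2 / 2) by ring]
  have := mul_le_mul_of_nonneg_left (h x) (Real.exp_pos (-(x ^ 2 / 2))).le
  linarith

lemma of_bounded {C : ℝ} (h : ∀ x, |g x| ≤ C) : GaussDecay g :=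
  of_le (D := C) fun x => (h x).trans
    (le_mul_of_one_le_right ((abs_nonneg _).trans (h x)) (by linarith [abs_nonneg x]))

lemma tendsto_atTop (hg : GaussDecay g) :
    Tendsto (fun x => Real.exp (-(x ^ 2 / 2)) * g x) atTop (nhds 0) :=
  hg.mono_left (by rw [cocompact_eq_atBot_atTop]; exact le_sup_right)

end GaussDecay

/-- `exp(-x²/2)` is the integrating factor of the Stein operator `g' - x g`. -/
lemma hasDerivAt_exp_neg_sq_mul {g : ℝ → ℝ} {g' x : ℝ} (hg : HasDerivAt g g' x) :
    HasDerivAt (fun x => Real.exp (-(x ^ 2 / 2)) * g x)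
      (Real.exp (-(x ^ 2 / 2)) * (g' - x * g x)) x := by
  have h : HasDerivAt (fun x : ℝ => Real.exp (-(x ^ 2 / 2))) (Real.exp (-(x ^ 2 / 2)) * (-x)) x := by
    refine HasDerivAt.exp ?_
    refine (((hasDerivAt_pow 2 x).div_const 2).neg).congr_deriv ?_
    simp
  refine (h.mul hg).congr_deriv ?_
  ring

/-- A barrier for the solutions of `g' - x g = k` that are small at infinity. -/
lemma le_barrier {g k B B' : ℝ → ℝ} {a : ℝ}
    (hg : ∀ x, a ≤ x → HasDerivAt g (x * g x + k x) x) (hdg : GaussDecay g)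
    (hB : ∀ x, a ≤ x → HasDerivAt B (B' x) x)
    (hdB : Tendsto (fun x => Real.exp (-(x ^ 2 / 2)) * B x) atTop (nhds 0))
    (hk : ∀ x, a ≤ x → B' x - x * B x ≤ k x) {x : ℝ} (hx : a ≤ x) : g x ≤ B x := by
  have hd : ∀ y, a ≤ y → HasDerivAt (fun x => Real.exp (-(x ^ 2 / 2)) * (g x - B x))
      (Real.exp (-(y ^ 2 / 2)) * (y * g y + k y - B' y - y * (g y - B y))) y :=
    fun y hy => hasDerivAt_exp_neg_sq_mul ((hg y hy).sub (hB y hy))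
  -- `exp(-x²/2) (g - B)` increases on `[a, ∞)` and tends to `0`, hence is nonpositive.
  have mono : MonotoneOn (fun x => Real.exp (-(x ^ 2 / 2)) * (g x - B x)) (Set.Ici a) := by
    refine monotoneOn_of_deriv_nonneg (convex_Ici a)
      (fun y hy => (hd y hy).continuousAt.continuousWithinAt) (fun y hy => ?_) (fun y hy => ?_)
    · rw [interior_Ici] at hy
      exact (hd y (le_of_lt hy)).differentiableAt.differentiableWithinAt
    · rw [interior_Ici] at hy
      rw [(hd y (le_of_lt hy)).deriv]
      refine mul_nonneg (Real.exp_pos _).le ?_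
      linarith [hk y (le_of_lt hy)]
  have hlim : Tendsto (fun x => Real.exp (-(x ^ 2 / 2)) * (g x - B x)) atTop (nhds 0) := by
    simpa [mul_sub] using hdg.tendsto_atTop.sub hdB
  have h0 : Real.exp (-(x ^ 2 / 2)) * (g x - B x) ≤ 0 := by
    refine ge_of_tendsto hlim ?_
    filter_upwards [eventually_ge_atTop x] with y hy
    exact mono hx (hx.trans hy) hy
  have := nonpos_of_mul_nonpos_right h0 (Real.exp_pos _)
  linarith

/-- The lower bound comes from `-g`, and the negative half-line from `-g(-x)`, which solves the
Stein equation with data `k(-x)`. -/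
lemma abs_le_barrier {g k B B' : ℝ → ℝ}
    (hg : ∀ x, HasDerivAt g (x * g x + k x) x) (hdg : GaussDecay g)
    (hB : ∀ x, 1 ≤ x → HasDerivAt B (B' x) x)
    (hdB : Tendsto (fun x => Real.exp (-(x ^ 2 / 2)) * B x) atTop (nhds 0))
    (hk : ∀ x, 1 ≤ |x| → |k x| ≤ |x| * B |x| - B' |x|) {x : ℝ} (hx : 1 ≤ |x|) :
    |g x| ≤ B |x| := by
  have upper : ∀ {g k : ℝ → ℝ}, (∀ x, HasDerivAt g (x * g x + k x) x) → GaussDecay g →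
      (∀ x, 1 ≤ |x| → |k x| ≤ |x| * B |x| - B' |x|) → ∀ x, 1 ≤ x → |g x| ≤ B x := by
    intro g k hg hdg hk x hx
    have hk' : ∀ x, 1 ≤ x → |k x| ≤ x * B x - B' x := fun x hx => by
      have h := hk x (hx.trans (le_abs_self x))
      rwa [abs_of_pos (show 0 < x by linarith)] at h
    rw [abs_le]
    constructor
    · have := le_barrier (g := fun x => -g x) (k := fun x => -k x) (a := 1)
        (fun x _ => ((hg x).neg).congr_deriv (by ring)) hdg.neg hB hdB
        (fun x hx => by linarith [(abs_le.1 (hk' x hx)).2]) hx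
      linarith
    · exact le_barrier (a := 1) (fun x _ => hg x) hdg hB hdB
        (fun x hx => by linarith [(abs_le.1 (hk' x hx)).1]) hx
  rcases le_total 0 x with h0 | h0
  · rw [abs_of_nonneg h0] at hx ⊢
    exact upper hg hdg hk x hx
  · rw [abs_of_nonpos h0] at hx ⊢
    have hr : ∀ x, HasDerivAt (fun x => -g (-x)) (x * -g (-x) + k (-x)) x := fun x => by
      refine (((hg (-x)).comp x (hasDerivAt_neg x)).neg).congr_deriv ?_
      ring
    have := upper (g := fun x => -g (-x)) (k := fun x => k (-x)) hr hdg.comp_neg.neg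
      (fun x hx => by simpa using hk (-x) (by simpa using hx)) (-x) hx
    simpa using this

lemma exists_abs_le_of_one_le_abs {g : ℝ → ℝ} (hg : Continuous g) {C : ℝ}
    (h : ∀ x, 1 ≤ |x| → |g x| ≤ C) : ∃ C', ∀ x, |g x| ≤ C' := by
  obtain ⟨D, hD⟩ := (isCompact_Icc (a := (-1 : ℝ)) (b := 1)).exists_bound_of_continuousOn
    hg.continuousOn
  refine ⟨max C D, fun x => ?_⟩
  rcases le_total 1 |x| with hx | hx
  · exact (h x hx).trans (le_max_left _ _)
  · exact (hD x (abs_le.1 hx)).trans (le_max_right _ _)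

/-- The constant `2D` is a barrier, since `2D x ≥ D(1 + x)` for `x ≥ 1`. -/
lemma exists_abs_le_of_stein_linear {g k : ℝ → ℝ} {D : ℝ}
    (hg : ∀ x, HasDerivAt g (x * g x + k x) x) (hdg : GaussDecay g)
    (hk : ∀ x, |k x| ≤ D * (1 + |x|)) : ∃ C, ∀ x, |g x| ≤ C := by
  have hD : 0 ≤ D := by simpa using (abs_nonneg _).trans (hk 0)
  refine exists_abs_le_of_one_le_abs (C := 2 * D)
    (continuous_iff_continuousAt.2 fun x => (hg x).continuousAt) fun x hx => ?_
  refine abs_le_barrier (B := fun _ => 2 * D) (B' := fun _ => 0) hg hdg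
    (fun x _ => hasDerivAt_const x _) ?_ (fun x hx => ?_) hx
  · exact (GaussDecay.of_bounded (g := fun _ => 2 * D) (C := |2 * D|) fun _ => le_rfl).tendsto_atTop
  · have := hk x
    nlinarith

/-- The barrier `K/x` satisfies `x B - B' = K + K/x² ≥ K`. Its decay bounds `x g` as well, and
therefore `g' = x g + k`. -/
lemma exists_abs_le_of_stein_bounded {g k : ℝ → ℝ} {K : ℝ}
    (hg : ∀ x, HasDerivAt g (x * g x + k x) x) (hdg : GaussDecay g)
    (hk : ∀ x, |k x| ≤ K) : ∃ C, ∀ x, |g x| ≤ C ∧ |x * g x + k x| ≤ C := by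
  have hK : 0 ≤ K := (abs_nonneg _).trans (hk 0)
  have hcont : Continuous g := continuous_iff_continuousAt.2 fun x => (hg x).continuousAt
  have hfar : ∀ x, 1 ≤ |x| → |g x| ≤ K / |x| := fun x hx => by
    refine abs_le_barrier (B := fun x => K / x) (B' := fun x => -(K / x ^ 2)) hg hdg
      (fun x hx => ?_) ?_ (fun x hx => ?_) hx
    · have hx0 : x ≠ 0 := by linarith
      refine ((hasDerivAt_inv hx0).const_mul K).congr_deriv ?_ |>.congr_of_eventuallyEq ?_
      · field_simp
      · exact Eventually.of_forall fun y => div_eq_mul_inv K y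
    · have h1 := (GaussDecay.of_bounded (g := fun _ => K) (C := |K|) fun _ => le_rfl).tendsto_atTop
      refine squeeze_zero' ?_ ?_ h1
      · filter_upwards [eventually_ge_atTop 1] with x hx
        positivity
      · filter_upwards [eventually_ge_atTop 1] with x hx
        gcongr
        exact div_le_self hK hx
    · have hx0 : 0 < |x| := by linarith
      have : 0 ≤ K / |x| ^ 2 := by positivity
      rw [mul_div_cancel₀ _ hx0.ne']
      linarith [hk x]
  obtain ⟨C, hC⟩ := exists_abs_le_of_one_le_abs hcont (C := K)
    fun x hx => (hfar x hx).trans (div_le_self hK hx)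
  obtain ⟨D, hD⟩ := exists_abs_le_of_one_le_abs (g := fun x => x * g x) (by fun_prop) (C := K)
    fun x hx => by
      have hx0 : 0 < |x| := by linarith
      have := hfar x hx
      rw [le_div_iff₀ hx0] at this
      rw [abs_mul]; linarith
  refine ⟨max C (D + K), fun x => ⟨(hC x).trans (le_max_left _ _), ?_⟩⟩
  exact ((abs_add_le _ _).trans (add_le_add (hD x) (hk x))).trans (le_max_right _ _)

/-- The difference times the integrating factor is constant and tends to `0`. This uniqueness
transfers symmetry from `h` to the solution. -/
lemma eq_of_stein_eq {f g k : ℝ → ℝ} (hf : ∀ x, HasDerivAt f (x * f x + k x) x)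
    (hg : ∀ x, HasDerivAt g (x * g x + k x) x) (hdf : GaussDecay f) (hdg : GaussDecay g) :
    f = g := by
  have hd : ∀ x, HasDerivAt (fun x => Real.exp (-(x ^ 2 / 2)) * (f x - g x)) 0 x := fun x => by
    refine (hasDerivAt_exp_neg_sq_mul ((hf x).sub (hg x))).congr_deriv ?_
    simp only [Pi.sub_apply]
    ring
  have hc := is_const_of_deriv_eq_zero (fun x => (hd x).differentiableAt) fun x => (hd x).deriv
  ext x
  have hlim : Tendsto (fun _ : ℝ => Real.exp (-(x ^ 2 / 2)) * (f x - g x)) atTop (nhds 0) :=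
    (hdf.sub hdg).tendsto_atTop.congr fun y => hc y x
  have h0 := tendsto_nhds_unique tendsto_const_nhds hlim
  have := (mul_eq_zero.1 h0).resolve_left (Real.exp_pos _).ne'
  linarith

/-- Functions with bounded derivative have linear growth. -/
lemma exists_abs_le_mul_one_add_abs {h : ℝ → ℝ} (hd : Differentiable ℝ h) {M : ℝ}
    (hM : ∀ x, |deriv h x| ≤ M) : ∃ D, ∀ x, |h x| ≤ D * (1 + |x|) := by
  have hM0 : 0 ≤ M := (abs_nonneg _).trans (hM 0)
  refine ⟨|h 0| + M, fun x => ?_⟩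
  have h1 := Convex.norm_image_sub_le_of_norm_deriv_le (f := h) (s := Set.univ) (C := M)
    (fun x _ => hd x) (fun x _ => hM x) convex_univ (Set.mem_univ 0) (Set.mem_univ x)
  rw [sub_zero, Real.norm_eq_abs, Real.norm_eq_abs] at h1
  have h2 : |h x| ≤ |h x - h 0| + |h 0| := by
    simpa using abs_add_le (h x - h 0) (h 0)
  nlinarith [abs_nonneg x, abs_nonneg (h 0)]

lemma integrable_gaussianReal_of_deriv_bounded {h : ℝ → ℝ} (hd : Differentiable ℝ h) {M : ℝ}
    (hM : ∀ x, |deriv h x| ≤ M) : Integrable h (gaussianReal 0 1) := by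
  obtain ⟨D, hD⟩ := exists_abs_le_mul_one_add_abs hd hM
  have hid : Integrable (fun x : ℝ => |x|) (gaussianReal 0 1) :=
    ((memLp_id_gaussianReal (μ := 0) (v := 1) 1).integrable (by simp)).abs
  refine (((integrable_const 1).add hid).const_mul D).mono' hd.continuous.aestronglyMeasurable
    (Eventually.of_forall fun x => hD x)

/-- The solution is `exp(x²/2)` times the integral of `exp(-t²/2) h(t)` up to `x`. Zero mean makes
that integral vanish at both ends, which is the decay condition. -/
lemma exists_stein_solution {h : ℝ → ℝ} (hc : Continuous h) {D : ℝ}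
    (hD : ∀ x, |h x| ≤ D * (1 + |x|)) (h0 : ∫ x, h x ∂(gaussianReal 0 1) = 0) :
    ∃ f : ℝ → ℝ, (∀ x, HasDerivAt f (x * f x + h x) x) ∧ GaussDecay f := by
  set H : ℝ → ℝ := fun x => Real.exp (-(x ^ 2 / 2)) * h x with hH
  have hHc : Continuous H := by fun_prop
  have hHi : Integrable H := by
    have i0 := integrable_exp_neg_mul_sq (b := 1 / 2) (by norm_num)
    have i1 := (integrable_mul_exp_neg_mul_sq (b := 1 / 2) (by norm_num)).abs
    refine ((i0.add i1).const_mul D).mono' hHc.aestronglyMeasurable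
      (Eventually.of_forall fun x => ?_)
    simp only [hH, Pi.add_apply]
    rw [norm_mul, Real.norm_of_nonneg (Real.exp_pos _).le, Real.norm_eq_abs, abs_mul,
      Real.abs_exp, show -(1 / 2) * x ^ 2 = -(x ^ 2 / 2) by ring]
    have := mul_le_mul_of_nonneg_left (hD x) (Real.exp_pos (-(x ^ 2 / 2))).le
    linarith
  have hH0 : ∫ x, H x = 0 := by
    rw [integral_gaussianReal_eq_integral_smul one_ne_zero] at h0
    have e : (fun x => gaussianPDFReal 0 1 x • h x) =
        fun x => (Real.sqrt (2 * Real.pi))⁻¹ * H x := by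
      ext x
      rw [gaussianPDFReal, hH]
      simp only [NNReal.coe_one, mul_one, sub_zero, smul_eq_mul, neg_div]
      ring
    rw [e, integral_const_mul] at h0
    exact (mul_eq_zero.1 h0).resolve_left (inv_ne_zero
      (Real.sqrt_pos.2 (by positivity)).ne')
  set c := ∫ x in Set.Iic (0 : ℝ), H x with hc_def
  have hc' : c + ∫ x in Set.Ioi (0 : ℝ), H x = 0 := by
    have := integral_add_compl (s := Set.Iic (0 : ℝ)) measurableSet_Iic hHi
    rwa [Set.compl_Iic, hH0] at this
  set F : ℝ → ℝ := fun x => c + ∫ t in (0 : ℝ)..x, H t with hF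
  have hF' : ∀ x, HasDerivAt F (H x) x := fun x =>
    (intervalIntegral.integral_hasDerivAt_right (hHc.intervalIntegrable _ _)
      hHc.stronglyMeasurable.stronglyMeasurableAtFilter hHc.continuousAt).const_add c
  have hTop : Tendsto F atTop (nhds 0) := by
    rw [← hc']
    exact (intervalIntegral_tendsto_integral_Ioi 0 hHi.integrableOn tendsto_id).const_add c
  have hBot : Tendsto F atBot (nhds 0) := by
    have h1 := (intervalIntegral_tendsto_integral_Iic 0 hHi.integrableOn tendsto_id).const_sub c
    rw [← hc_def, sub_self] at h1
    refine h1.congr fun x => ?_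
    rw [hF, intervalIntegral.integral_symm]
    simp
  refine ⟨fun x => Real.exp (x ^ 2 / 2) * F x, fun x => ?_, ?_⟩
  · have h1 : HasDerivAt (fun x : ℝ => Real.exp (x ^ 2 / 2)) (Real.exp (x ^ 2 / 2) * x) x := by
      refine HasDerivAt.exp (((hasDerivAt_pow 2 x).div_const 2).congr_deriv ?_)
      simp
    have h2 : Real.exp (x ^ 2 / 2) * H x = h x := by
      rw [hH, ← mul_assoc, ← Real.exp_add]
      simp
    refine (h1.mul (hF' x)).congr_deriv ?_
    rw [h2]
    ring
  · rw [GaussDecay, cocompact_eq_atBot_atTop]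
    refine (hBot.sup hTop).congr fun x => ?_
    rw [← mul_assoc, ← Real.exp_add]
    simp

/-! ### Taylor bounds -/

lemma abs_taylor_one_le {f f₁ f₂ : ℝ → ℝ} (h0 : ∀ x, HasDerivAt f (f₁ x) x)
    (h1 : ∀ x, HasDerivAt f₁ (f₂ x) x) {C : ℝ} (hC : ∀ x, |f₂ x| ≤ C) (x : ℝ) {δ : ℝ}
    (hδ : 0 ≤ δ) : |f (x + δ) - f x - δ * f₁ x| ≤ C * δ ^ 2 := by
  have hd : ∀ s ∈ Set.Icc 0 δ, HasDerivWithinAt (fun s => f (x + s) - s * f₁ x)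
      (f₁ (x + s) - f₁ x) (Set.Icc 0 δ) s := fun s _ => by
    refine ((((h0 (x + s)).comp_const_add x s).sub
      ((hasDerivAt_id s).mul_const (f₁ x))).congr_deriv ?_).hasDerivWithinAt
    simp
  have hb : ∀ s ∈ Set.Icc 0 δ, ‖f₁ (x + s) - f₁ x‖ ≤ C * δ := fun s hs => by
    have := Convex.norm_image_sub_le_of_norm_hasDerivWithin_le (s := Set.univ) (f := f₁) (f' := f₂)
      (fun y _ => (h1 y).hasDerivWithinAt) (fun y _ => hC y) convex_univ (Set.mem_univ x)
      (Set.mem_univ (x + s))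
    refine this.trans ?_
    rw [add_sub_cancel_left, Real.norm_of_nonneg hs.1]
    have hC0 : 0 ≤ C := (abs_nonneg _).trans (hC 0)
    gcongr
    exact hs.2
  have := Convex.norm_image_sub_le_of_norm_hasDerivWithin_le hd hb (convex_Icc 0 δ)
    (Set.left_mem_Icc.2 hδ) (Set.right_mem_Icc.2 hδ)
  rw [Real.norm_eq_abs, sub_zero, Real.norm_of_nonneg hδ, zero_mul, sub_zero, add_zero] at this
  calc _ = |f (x + δ) - δ * f₁ x - f x| := by congr 1; ring
    _ ≤ _ := this
    _ = _ := by ring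

lemma abs_taylor_two_le {f f₁ f₂ f₃ : ℝ → ℝ} (h0 : ∀ x, HasDerivAt f (f₁ x) x)
    (h1 : ∀ x, HasDerivAt f₁ (f₂ x) x) (h2 : ∀ x, HasDerivAt f₂ (f₃ x) x) {C : ℝ}
    (hC : ∀ x, |f₃ x| ≤ C) (x : ℝ) {δ : ℝ} (hδ : 0 ≤ δ) :
    |f (x + δ) - f x - δ * f₁ x - δ ^ 2 / 2 * f₂ x| ≤ C * δ ^ 3 := by
  have hd : ∀ s ∈ Set.Icc 0 δ, HasDerivWithinAt (fun s => f (x + s) - s * f₁ x - s ^ 2 / 2 * f₂ x)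
      (f₁ (x + s) - f₁ x - s * f₂ x) (Set.Icc 0 δ) s := fun s _ => by
    refine (((((h0 (x + s)).comp_const_add x s).sub ((hasDerivAt_id s).mul_const (f₁ x))).sub
      (((hasDerivAt_pow 2 s).div_const 2).mul_const (f₂ x))).congr_deriv ?_).hasDerivWithinAt
    simp
  have hb : ∀ s ∈ Set.Icc 0 δ, ‖f₁ (x + s) - f₁ x - s * f₂ x‖ ≤ C * δ ^ 2 := fun s hs => by
    refine (abs_taylor_one_le h1 h2 hC x hs.1).trans ?_
    have hC0 : 0 ≤ C := (abs_nonneg _).trans (hC 0)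
    have := hs.1
    gcongr
    exact hs.2
  have := Convex.norm_image_sub_le_of_norm_hasDerivWithin_le hd hb (convex_Icc 0 δ)
    (Set.left_mem_Icc.2 hδ) (Set.right_mem_Icc.2 hδ)
  rw [Real.norm_eq_abs, sub_zero, Real.norm_of_nonneg hδ] at this
  calc _ = |f (x + δ) - δ * f₁ x - δ ^ 2 / 2 * f₂ x -
        (f (x + 0) - 0 * f₁ x - 0 ^ 2 / 2 * f₂ x)| := by rw [add_zero]; congr 1; ring
    _ ≤ _ := this
    _ = _ := by ring

/-! ### Stein's method for the standardized Poisson law -/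

section poisson

variable {α : ℝ}

/-- At `ν = 1` the law is Poisson, so the calculus of `cmpMean` applies to part (c). -/
lemma cmpWeight_one (α : ℝ) (k : ℕ) : cmpWeight 1 α k = α ^ k / (Nat.factorial k : ℝ) :=
  Real.rpow_one _

lemma tsum_cmpWeight_one (α : ℝ) : ∑' k, cmpWeight 1 α k = Real.exp α := by
  simp only [cmpWeight_one]
  rw [Real.exp_eq_exp_ℝ, NormedSpace.exp_eq_tsum_div]

lemma stdPoissonExp_eq_cmpMean (hα : 0 < α) (h : ℝ → ℝ) :
    stdPoissonExp h α = cmpMean 1 α (fun k => h (((k : ℝ) - α) / Real.sqrt α)) := by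
  rw [stdPoissonExp, poissonLaw, integral_poissonMeasure, cmpMean, tsum_cmpWeight_one,
    div_eq_inv_mul, ← tsum_mul_left]
  refine tsum_congr fun k => ?_
  rw [cmpWeight_one, Real.coe_toNNReal _ hα.le, Real.exp_neg, smul_eq_mul]
  ring

lemma polyGrowth_standardized (α : ℝ) :
    PolyGrowth (fun k => ((k : ℝ) - α) / Real.sqrt α) := by
  simpa only [div_eq_inv_mul] using
    (PolyGrowth.cast.sub (PolyGrowth.const α)).const_mul (Real.sqrt α)⁻¹

lemma polyGrowth_comp_standardized {h : ℝ → ℝ} {D : ℝ} (hD : ∀ x, |h x| ≤ D * (1 + |x|)) (α : ℝ) :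
    PolyGrowth (fun k => h (((k : ℝ) - α) / Real.sqrt α)) :=
  (((PolyGrowth.const 1).add (polyGrowth_standardized α).abs).const_mul D).of_le
    fun _ => (hD _).trans (le_abs_self _)

lemma polyGrowth_comp_of_bounded {h : ℝ → ℝ} {C : ℝ} (hC : ∀ x, |h x| ≤ C) (g : ℕ → ℝ) :
    PolyGrowth (fun k => h (g k)) :=
  (PolyGrowth.const C).of_le fun _ => (hC _).trans (le_abs_self _)

lemma integrable_poissonLaw_of_polyGrowth (hα : 0 < α) {g : ℕ → ℝ} (hg : PolyGrowth g) :
    Integrable g (poissonLaw α) := by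
  rw [poissonLaw, integrable_poissonMeasure_iff]
  refine ((hg.abs.summable one_pos hα).mul_left (Real.exp (-α))).congr fun k => ?_
  rw [cmpWeight_one, Real.coe_toNNReal _ hα.le, Real.norm_eq_abs]
  ring

/-- The Stein identity for the standardized Poisson law. -/
lemma cmpMean_one_standardized_mul (hα : 0 < α) {f : ℝ → ℝ} {C : ℝ} (hC : ∀ x, |f x| ≤ C) :
    cmpMean 1 α (fun k => ((k : ℝ) - α) / Real.sqrt α * f (((k : ℝ) - α) / Real.sqrt α)) =
      Real.sqrt α * cmpMean 1 α (fun k => f (((k : ℝ) - α) / Real.sqrt α + 1 / Real.sqrt α) -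
        f (((k : ℝ) - α) / Real.sqrt α)) := by
  have hs : 0 < Real.sqrt α := Real.sqrt_pos.2 hα
  have h := cmpMean_rpow_sub_one_mul one_pos hα
    (polyGrowth_comp_of_bounded hC fun k : ℕ => ((k : ℝ) - α) / Real.sqrt α)
  have e : ∀ k : ℕ, (((k + 1 : ℕ) : ℝ) - α) / Real.sqrt α =
      ((k : ℝ) - α) / Real.sqrt α + 1 / Real.sqrt α := fun k => by push_cast; ring
  simp only [e, Real.rpow_one] at h
  rw [← h, ← cmpMean_const_mul]
  congr 1; ext k
  have hα2 : α = Real.sqrt α * Real.sqrt α := (Real.mul_self_sqrt hα.le).symm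
  have e2 : ((k : ℝ) - α) / Real.sqrt α = Real.sqrt α * ((k : ℝ) / α - 1) := by
    rw [div_eq_iff hs.ne', mul_assoc, mul_comm _ (Real.sqrt α), ← mul_assoc, ← hα2]
    field_simp
  rw [← mul_assoc, ← e2]

/-- The Stein equation at `W` gives `E h(W) - m = E f₁(W) - E[W f(W)]`; the Stein identity replaces
the last term by a difference, leaving a first-order Taylor remainder. -/
lemma stdPoissonExp_sub_eq (hα : 0 < α) {h f f₁ : ℝ → ℝ} {m D C C₁ : ℝ}
    (hD : ∀ x, |h x| ≤ D * (1 + |x|)) (hf : ∀ x, f₁ x = x * f x + (h x - m))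
    (hC : ∀ x, |f x| ≤ C) (hC₁ : ∀ x, |f₁ x| ≤ C₁) :
    stdPoissonExp h α - m = -Real.sqrt α * cmpMean 1 α (fun k =>
      f (((k : ℝ) - α) / Real.sqrt α + 1 / Real.sqrt α) - f (((k : ℝ) - α) / Real.sqrt α) -
        1 / Real.sqrt α * f₁ (((k : ℝ) - α) / Real.sqrt α)) := by
  have hs : 0 < Real.sqrt α := Real.sqrt_pos.2 hα
  set W : ℕ → ℝ := fun k => ((k : ℝ) - α) / Real.sqrt α
  have ph : PolyGrowth fun k => h (W k) := polyGrowth_comp_standardized hD α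
  have pf : PolyGrowth fun k => f (W k) := polyGrowth_comp_of_bounded hC W
  have pf1 : PolyGrowth fun k => f₁ (W k) := polyGrowth_comp_of_bounded hC₁ W
  have pfs : PolyGrowth fun k => f (W k + 1 / Real.sqrt α) := polyGrowth_comp_of_bounded hC _
  have pW : PolyGrowth W := polyGrowth_standardized α
  have hmean : cmpMean 1 α (fun k => W k * f (W k)) =
      Real.sqrt α * cmpMean 1 α (fun k => f (W k + 1 / Real.sqrt α) - f (W k)) :=
    cmpMean_one_standardized_mul hα hC
  have e : (fun k => f₁ (W k)) = fun k => W k * f (W k) + (h (W k) - m) := by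
    ext k; exact hf _
  have h1 : cmpMean 1 α (fun k => f₁ (W k)) =
      cmpMean 1 α (fun k => W k * f (W k)) + (stdPoissonExp h α - m) := by
    rw [e, cmpMean_add one_pos hα (pW.mul pf) (ph.sub (PolyGrowth.const m)),
      cmpMean_sub one_pos hα ph (PolyGrowth.const m), cmpMean_const one_pos hα,
      stdPoissonExp_eq_cmpMean hα]
  rw [cmpMean_sub one_pos hα (pfs.sub pf) (pf1.const_mul _), cmpMean_const_mul, h1, hmean]
  generalize cmpMean 1 α (fun k => f (W k + 1 / Real.sqrt α) - f (W k)) = A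
  field_simp
  ring

/-- Differentiating the Stein equation, `f₁` solves one with data `f + h'`. These are bounded once
`f` is, so the barrier argument bounds `f₁` and `f₂` together. -/
lemma exists_stein_solution_bounded {h : ℝ → ℝ} (hd : Differentiable ℝ h) {M : ℝ}
    (hM : ∀ x, |deriv h x| ≤ M) :
    ∃ (f f₁ f₂ : ℝ → ℝ) (C : ℝ), (∀ x, HasDerivAt f (f₁ x) x) ∧ (∀ x, HasDerivAt f₁ (f₂ x) x) ∧
      (∀ x, f₁ x = x * f x + (h x - stdNormalExp h)) ∧
      (∀ x, f₂ x = x * f₁ x + (f x + deriv h x)) ∧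
      (∀ x, |f x| ≤ C) ∧ (∀ x, |f₁ x| ≤ C) ∧ (∀ x, |f₂ x| ≤ C) := by
  set m := stdNormalExp h with hm
  have hd' : Differentiable ℝ fun x => h x - m := hd.sub_const m
  have hderiv : ∀ x, deriv (fun x => h x - m) x = deriv h x := fun x => deriv_sub_const m
  obtain ⟨D, hD⟩ := exists_abs_le_mul_one_add_abs hd' (M := M) fun x => by rw [hderiv]; exact hM x
  have h0 : ∫ x, (h x - m) ∂(gaussianReal 0 1) = 0 := by
    rw [integral_sub (integrable_gaussianReal_of_deriv_bounded hd hM) (integrable_const m),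
      integral_const, hm, stdNormalExp]
    simp
  obtain ⟨f, hf, hdf⟩ := exists_stein_solution hd'.continuous hD h0
  obtain ⟨C, hC⟩ := exists_abs_le_of_stein_linear hf hdf hD
  set f₁ : ℝ → ℝ := fun x => x * f x + (h x - m) with hf1
  have hf1' : ∀ x, HasDerivAt f₁ (x * f₁ x + (f x + deriv h x)) x := fun x => by
    refine (((hasDerivAt_id x).mul (hf x)).add ((hd x).hasDerivAt.sub_const m)).congr_deriv ?_
    simp [hf1]
    ring
  have hdf1 : GaussDecay f₁ := GaussDecay.of_le (D := C + D) fun x => by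
    calc |f₁ x| ≤ |x * f x| + |h x - m| := abs_add_le _ _
      _ ≤ |x| * C + D * (1 + |x|) := by rw [abs_mul]; gcongr; exacts [hC x, hD x]
      _ ≤ _ := by nlinarith [(abs_nonneg _).trans (hC 0)]
  obtain ⟨C₁, hC₁⟩ := exists_abs_le_of_stein_bounded (K := C + M) hf1' hdf1
    fun x => (abs_add_le _ _).trans (add_le_add (hC x) (hM x))
  exact ⟨f, f₁, _, max C C₁, hf, hf1', fun _ => rfl, fun _ => rfl,
    fun x => (hC x).trans (le_max_left _ _), fun x => (hC₁ x).1.trans (le_max_right _ _),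
    fun x => (hC₁ x).2.trans (le_max_right _ _)⟩

lemma exists_abs_stdPoissonExp_sub_le {h : ℝ → ℝ} (hd : Differentiable ℝ h) {M : ℝ}
    (hM : ∀ x, |deriv h x| ≤ M) :
    ∃ C, ∀ α, 0 < α → |stdPoissonExp h α - stdNormalExp h| ≤ C * (1 / Real.sqrt α) := by
  obtain ⟨D, hD⟩ := exists_abs_le_mul_one_add_abs hd hM
  obtain ⟨f, f₁, f₂, C, h0, h1, e1, -, b0, b1, b2⟩ := exists_stein_solution_bounded hd hM
  refine ⟨C, fun α hα => ?_⟩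
  have hs : 0 < Real.sqrt α := Real.sqrt_pos.2 hα
  rw [stdPoissonExp_sub_eq hα hD e1 b0 b1, abs_mul, abs_neg, abs_of_pos hs]
  have hle := abs_cmpMean_le one_pos hα
    (((polyGrowth_comp_of_bounded b0
      fun k : ℕ => ((k : ℝ) - α) / Real.sqrt α + 1 / Real.sqrt α).sub
      (polyGrowth_comp_of_bounded b0 fun k : ℕ => ((k : ℝ) - α) / Real.sqrt α)).sub
      ((polyGrowth_comp_of_bounded b1 fun k : ℕ => ((k : ℝ) - α) / Real.sqrt α).const_mul
        (1 / Real.sqrt α)))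
    (PolyGrowth.const (C * (1 / Real.sqrt α) ^ 2))
    fun k => abs_taylor_one_le h0 h1 b2 _ (by positivity)
  rw [cmpMean_const one_pos hα] at hle
  calc _ ≤ Real.sqrt α * (C * (1 / Real.sqrt α) ^ 2) := by gcongr
    _ = _ := by field_simp

lemma stdNormalExp_eq_zero_of_odd {h : ℝ → ℝ} (hodd : ∀ x, h (-x) = -h x) :
    stdNormalExp h = 0 := by
  have e : stdNormalExp h = -stdNormalExp h := by
    have hmap : (gaussianReal 0 1).map (fun x : ℝ => -x) = gaussianReal 0 1 := by
      rw [gaussianReal_map_neg, neg_zero]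
    have h2 : ∫ x, h x ∂((gaussianReal 0 1).map fun x : ℝ => -x) =
        ∫ x, h (-x) ∂(gaussianReal 0 1) :=
      (Homeomorph.neg ℝ).measurableEmbedding.integral_map h
    rw [hmap] at h2
    rw [stdNormalExp, ← integral_neg, h2]
    exact integral_congr_ae (Eventually.of_forall hodd)
  linarith

/-- `f₂` solves a Stein equation with data `2 f₁ + h''`, so its derivative is bounded and a
second-order Taylor expansion is available. The first-order rate, applied to the odd function `f₂`,
gives `E f₂(W) = O(δ)`, making the quadratic term `O(δ³)` like the remainder. -/
lemma exists_abs_stdPoissonExp_sub_le_of_even {h : ℝ → ℝ} (heven : ∀ x, h (-x) = h x)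
    (hd : Differentiable ℝ h) {M : ℝ} (hM : ∀ x, |deriv h x| ≤ M)
    (hd2 : Differentiable ℝ (deriv h)) {M₂ : ℝ} (hM2 : ∀ x, |deriv (deriv h) x| ≤ M₂) :
    ∃ C, ∀ α, 0 < α → |stdPoissonExp h α - stdNormalExp h| ≤ C * (1 / α) := by
  obtain ⟨D, hD⟩ := exists_abs_le_mul_one_add_abs hd hM
  obtain ⟨f, f₁, f₂, C, h0, h1, e1, e2, b0, b1, b2⟩ := exists_stein_solution_bounded hd hM
  have h2 : ∀ x, HasDerivAt f₂ (x * f₂ x + (2 * f₁ x + deriv (deriv h) x)) x := fun x => by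
    rw [funext e2]
    refine (((hasDerivAt_id x).mul (h1 x)).add ((h0 x).add (hd2 x).hasDerivAt)).congr_deriv ?_
    simp [e2]
    ring
  obtain ⟨C₃, b3⟩ := exists_abs_le_of_stein_bounded (K := 2 * C + M₂) h2 (GaussDecay.of_bounded b2)
    fun x => by
      refine (abs_add_le _ _).trans (add_le_add ?_ (hM2 x))
      rw [abs_mul, abs_two]
      linarith [b1 x]
  -- For even `h`, `-f(-x)` solves the same equation with the same decay, so uniqueness makes `f`
  -- odd.
  have hodd : ∀ x, f (-x) = -f x := by
    have hs : ∀ x, HasDerivAt f (x * f x + (h x - stdNormalExp h)) x := fun x => by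
      rw [← e1]; exact h0 x
    have hr : ∀ x, HasDerivAt (fun x => -f (-x)) (x * -f (-x) + (h x - stdNormalExp h)) x :=
      fun x => by
        refine (((hs (-x)).comp x (hasDerivAt_neg x)).neg).congr_deriv ?_
        rw [heven]
        ring
    have hdf := GaussDecay.of_bounded b0
    have := eq_of_stein_eq hs hr hdf hdf.comp_neg.neg
    intro x
    have := congrFun this x
    linarith
  have hdodd : ∀ x, deriv h (-x) = -deriv h x := fun x => by
    have := deriv_comp_neg h x
    simp only [heven] at this
    linarith
  have hodd1 : ∀ x, f₁ (-x) = f₁ x := fun x => by rw [e1, e1, hodd, heven]; ring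
  have hodd2 : ∀ x, f₂ (-x) = -f₂ x := fun x => by rw [e2, e2, hodd, hodd1, hdodd]; ring
  have hder2 : deriv f₂ = fun x => x * f₂ x + (2 * f₁ x + deriv (deriv h) x) :=
    funext fun x => (h2 x).deriv
  obtain ⟨E, hE⟩ := exists_abs_stdPoissonExp_sub_le (h := f₂)
    (fun x => (h2 x).differentiableAt) (M := C₃) fun x => by rw [hder2]; exact (b3 x).2
  refine ⟨C₃ + E / 2, fun α hα => ?_⟩
  have hs : 0 < Real.sqrt α := Real.sqrt_pos.2 hα
  have hsq : Real.sqrt α ^ 2 = α := Real.sq_sqrt hα.le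
  have hE' := hE α hα
  rw [stdNormalExp_eq_zero_of_odd hodd2, sub_zero, stdPoissonExp_eq_cmpMean hα] at hE'
  rw [stdPoissonExp_sub_eq hα hD e1 b0 b1]
  set W : ℕ → ℝ := fun k => ((k : ℝ) - α) / Real.sqrt α
  set δ := 1 / Real.sqrt α with hδ
  have hδ0 : 0 < δ := by positivity
  have hsδ : Real.sqrt α * δ = 1 := by rw [hδ]; field_simp
  have hδ2 : δ ^ 2 = 1 / α := by rw [hδ, div_pow, hsq, one_pow]
  have pR := ((polyGrowth_comp_of_bounded b0 fun k => W k + δ).sub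
      (polyGrowth_comp_of_bounded b0 W)).sub ((polyGrowth_comp_of_bounded b1 W).const_mul δ)
  have p2 := (polyGrowth_comp_of_bounded b2 W).const_mul (δ ^ 2 / 2)
  have hle := abs_cmpMean_le one_pos hα (pR.sub p2) (PolyGrowth.const (C₃ * δ ^ 3))
    fun k => abs_taylor_two_le h0 h1 h2 (fun x => (b3 x).2) _ hδ0.le
  rw [cmpMean_const one_pos hα, cmpMean_sub one_pos hα pR p2, cmpMean_const_mul] at hle
  set R := cmpMean 1 α fun k => f (W k + δ) - f (W k) - δ * f₁ (W k)
  set m₂ := cmpMean 1 α fun k => f₂ (W k)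
  have h5 : |R| ≤ C₃ * δ ^ 3 + δ ^ 2 / 2 * (E * δ) := by
    calc |R| = |(R - δ ^ 2 / 2 * m₂) + δ ^ 2 / 2 * m₂| := by congr 1; ring
      _ ≤ |R - δ ^ 2 / 2 * m₂| + |δ ^ 2 / 2 * m₂| := abs_add_le _ _
      _ ≤ _ := by
        rw [abs_mul, abs_of_pos (by positivity : 0 < δ ^ 2 / 2)]
        gcongr
  rw [abs_mul, abs_neg, abs_of_pos hs]
  calc _ ≤ Real.sqrt α * (C₃ * δ ^ 3 + δ ^ 2 / 2 * (E * δ)) := by gcongr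
    _ = (Real.sqrt α * δ) * δ ^ 2 * (C₃ + E / 2) := by ring
    _ = _ := by rw [hsδ, hδ2]; ring

end poisson

theorem mainTheorem3 :
    -- the normalizing constant, for every `ν > 0`
    (∀ ν : ℝ, 0 < ν →
      -- the series converges
      (∀ lam : ℝ, 0 < lam →
        Summable (fun i : ℕ => lam ^ i / (Nat.factorial i : ℝ) ^ ν)) ∧
      -- `Z(lam, ν) = leading term * (1 + O(lam ^ (-1/ν)))` as `lam → ∞`
      (∃ ε : ℝ → ℝ,
        ε =O[atTop] (fun lam : ℝ => lam ^ (-(1 / ν))) ∧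
        ∀ lam : ℝ, 0 < lam → cmpZ lam ν = cmpLeading lam ν * (1 + ε lam)) ∧
      -- `Z(lam, ν) = e ^ α * E[(α ^ X / X!) ^ (ν - 1)]`, `X ∼ Po(α)`, `α = lam ^ (1/ν)`
      (∀ lam α : ℝ, 0 < lam → α = lam ^ (1 / ν) →
        Integrable (fun k : ℕ => (α ^ k / (Nat.factorial k : ℝ)) ^ (ν - 1)) (poissonLaw α) ∧
        cmpZ lam ν =
          Real.exp α * ∫ k : ℕ, (α ^ k / (Nat.factorial k : ℝ)) ^ (ν - 1) ∂(poissonLaw α))) ∧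
    -- normal approximation for `h` with bounded derivative, with rate `α ^ (-1/2)`
    (∀ h : ℝ → ℝ, Differentiable ℝ h → (∃ M : ℝ, ∀ x, |deriv h x| ≤ M) →
      Integrable h (gaussianReal 0 1) ∧
      (∀ α : ℝ, 0 < α →
        Integrable (fun k : ℕ => h (((k : ℝ) - α) / Real.sqrt α)) (poissonLaw α)) ∧
      (fun α : ℝ => stdPoissonExp h α - stdNormalExp h)
        =O[atTop] (fun α : ℝ => α ^ (-(1 / 2) : ℝ))) ∧
    -- normal approximation for even `h` with two bounded derivatives, with rate `α ^ (-1)`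
    (∀ h : ℝ → ℝ, (∀ x, h (-x) = h x) →
      Differentiable ℝ h → (∃ M : ℝ, ∀ x, |deriv h x| ≤ M) →
      Differentiable ℝ (deriv h) → (∃ M : ℝ, ∀ x, |deriv (deriv h) x| ≤ M) →
      (fun α : ℝ => stdPoissonExp h α - stdNormalExp h)
        =O[atTop] (fun α : ℝ => α ^ (-1 : ℝ))) := by
  refine ⟨fun ν hν => ⟨fun lam hl => summable_cmpZ hν hl,
    exists_isBigO_cmpZ_of_tendsto hν (tendsto_cmpLogRemainder_natCast_rpow hν),
    fun lam α hl hα => integrable_and_cmpZ_eq_exp_mul_integral hν hl hα⟩, ?_, ?_⟩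
  · rintro h hd ⟨M, hM⟩
    obtain ⟨D, hD⟩ := exists_abs_le_mul_one_add_abs hd hM
    obtain ⟨C, hC⟩ := exists_abs_stdPoissonExp_sub_le hd hM
    refine ⟨integrable_gaussianReal_of_deriv_bounded hd hM, fun α hα =>
      integrable_poissonLaw_of_polyGrowth hα (polyGrowth_comp_standardized hD α),
      IsBigO.of_bound C ?_⟩
    filter_upwards [eventually_gt_atTop 0] with α hα
    rw [Real.norm_eq_abs, Real.norm_of_nonneg (by positivity), Real.rpow_neg hα.le,
      ← Real.sqrt_eq_rpow, ← one_div]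
    exact hC α hα
  · rintro h heven hd ⟨M, hM⟩ hd2 ⟨M₂, hM2⟩
    obtain ⟨C, hC⟩ := exists_abs_stdPoissonExp_sub_le_of_even heven hd hM hd2 hM2
    refine IsBigO.of_bound C ?_
    filter_upwards [eventually_gt_atTop 0] with α hα
    rw [Real.norm_eq_abs, Real.norm_of_nonneg (by positivity), Real.rpow_neg_one, ← one_div]
    exact hC α hα
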